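/- **Theorem (Seidel).** Let $\mathbf{k}$ be a field of characteristic zero. A $\mathbb{Z}$-graded $A_\infty$-algebra $\mathcal{A}$ over $\mathbf{k}$ is pure if and only if it is formal. Here the terms have the following meaning. Write $|a|$ for the degree of a homogeneous element and $\dagger_i=\sum_{t=1}^{i}(|a_t|-1)$. *$A_\infty$-algebras.* For graded vector spaces $\mathcal{A},\mathcal{B}$ and $e\in\mathbb{Z}$ let $CC^e(\mathcal{A},\mathcal{B})=\prod_{s\ge 0}\mathrm{Hom}_e(\mathcal{A}[1]^{\otimes s},\mathcal{B})$; thus the component $\sigma^s$ of $\sigma\in CC^e(\mathcal{A},\mathcal{B})$ satisfies $|\sigma^s(a_s,\dots,a_1)|=\sum_t(|a_t|-1)+e$. For $\sigma\in CC^{e}(\mathcal{A},\mathcal{B})$ and $\tau\in CC^{e'}(\mathcal{A},\mathcal{A})$ put $$(\sigma\circ\tau)^d(a_d,\dots,a_1)=\sum_{i,j\ge 0,\ i+j\le d}(-1)^{(e'-1)\dagger_i}\,\sigma^{d-j+1}\bigl(a_d,\dots,a_{i+j+1},\tau^j(a_{i+j},\dots,a_{i+1}),a_i,\dots,a_1\bigr).$$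 A (not necessarily unital) $A_\infty$-algebra over $\mathbf{k}$ is a $\mathbb{Z}$-graded $\mathbf{k}$-vector space $\mathcal{A}$ with an element $\mu=(\mu^d)_{d\ge 1}\in CC^2(\mathcal{A},\mathcal{A})$, $\mu^0=0$, such that $\mu\circ\mu=0$. Its cohomology $A=H(\mathcal{A})=\ker\mu^1/\operatorname{im}\mu^1$ is a graded vector space, and is itself an $A_\infty$-algebra whose only non-zero operation is $\mu^2_A([a_2],[a_1])=[\mu^2(a_2,a_1)]$. *Formality.* An $A_\infty$-homomorphism $F:\mathcal{A}\to\mathcal{B}$ is an element $F\in CC^1(\mathcal{A},\mathcal{B})$ with $F^0=0$ such that for all $d$ $$\sum_{r}\ \sum_{s_1+\dots+s_r=d,\ s_t\ge 1}\mu^r_{\mathcal{B}}\bigl(F^{s_r}(a_d,\dots),\dots,F^{s_1}(a_{s_1},\dots,a_1)\bigr)=(F\circ\mu_{\mathcal{A}})^d(a_d,\dots,a_1).$$ It is a quasi-isomorphism if the map $H(\mathcal{A})\to H(\mathcal{B})$ induced by the chain map $F^1$ is bijective. $\mathcal{A}$ is formal if there is an $A_\infty$-quasi-isomorphism $\mathcal{A}\to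 H(\mathcal{A})$. *Purity.* The Hochschild differential of $\sigma\in CC^{e}(\mathcal{A},\mathcal{A})$ is $\delta\sigma=\mu\circ\sigma+(-1)^{e}\,\sigma\circ\mu$. An nc-vector field is an element $b\in CC^1(\mathcal{A},\mathcal{A})$ with $\delta b=0$. If $b^0=0$, then $b^1$ is a chain map and induces an endomorphism of $H(\mathcal{A})$; the nc-vector field $b$ is pure if $b^0=0$ and this endomorphism is the Euler vector field, i.e. multiplication by $i$ on $H^i(\mathcal{A})$ for every $i\in\mathbb{Z}$. $\mathcal{A}$ is pure if it admits a pure nc-vector field. -/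

import Mathlib

open Finset

/-! `A∞`-algebras over a field: Hochschild cochains, cohomology algebra, homomorphisms,
formality and purity.  Signs are those of Seidel's book: inputs `a_d, …, a_1`, reduced degrees
`‖a‖ = |a| - 1`, operators acting from the right.  A word `a_d, …, a_1` is encoded as the tuple
`i ↦ a_{i+1}`; thus `μ²(a_2, a_1)` is `μ.map 2 ![a_1, a_2]`. -/

namespace AInfinity

universe u v w

section Cochains

variable {k : Type u} [Field k] {A : Type v} [AddCommGroup A] [Module k A]
  {B : Type w} [AddCommGroup B] [Module k B]

/-- An element of `∏_{s ≥ 0} Hom_e(A[1]^{⊗ s}, B)`: for each `s ≥ 0` a `k`-multilinear map in `s`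
variables sending homogeneous elements of degrees `p₁, …, p_s` to an element of degree
`∑ (pᵢ - 1) + e`. For `A = B` this is the group `CC^e(A, A)` of Hochschild cochains. -/
structure Cochain (gA : ℤ → Submodule k A) (gB : ℤ → Submodule k B) (e : ℤ) where
  map : (s : ℕ) → MultilinearMap k (fun _ : Fin s => A) B
  map_mem : ∀ (s : ℕ) (p : Fin s → ℤ) (a : Fin s → A), (∀ i, a i ∈ gA (p i)) →
    map s a ∈ gB ((∑ i, (p i - 1)) + e)

/-- The first order part of a cochain, as a linear map. -/
def Cochain.linear {gA : ℤ → Submodule k A} {gB : ℤ → Submodule k B} {e : ℤ}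
    (σ : Cochain gA gB e) : A →ₗ[k] B :=
  (MultilinearMap.ofSubsingleton k A B (0 : Fin 1)).symm (σ.map 1)

/-- `†_i = ∑_{t = 1}^{i} (|a_t| - 1)` for a sequence of degrees; `p t` is the degree of
`a_{t+1}`. -/
def dagger (p : ℕ → ℤ) (i : ℕ) : ℤ := ∑ t ∈ range i, (p t - 1)

/-- The sequence `a_1, …, a_i, y, a_{i+j+1}, a_{i+j+2}, …`, in which the block
`a_{i+1}, …, a_{i+j}` has been replaced by the single entry `y`. -/
def replaceBlock (a : ℕ → A) (i j : ℕ) (y : A) (t : ℕ) : A :=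
  if t < i then a t else if t = i then y else a (t + j - 1)

/-- The value on a word `a_d, …, a_1` (the first `d` terms of the sequence `a`, homogeneous of
degrees `p`) of the convolution
`(σ ∘ τ)^d(a_d, …, a_1) = ∑_{i,j} (-1)^{(|τ|-1) †_i}
  σ^{d-j+1}(a_d, …, τ^j(a_{i+j}, …, a_{i+1}), a_i, …, a_1)`,
the sum being over `j ≥ 0`, `i ≥ 0` with `i + j ≤ d`. -/
def convolution {gA : ℤ → Submodule k A} {gB : ℤ → Submodule k B} {e e' : ℤ}
    (σ : Cochain gA gB e) (τ : Cochain gA gA e') (p : ℕ → ℤ) (a : ℕ → A) (d : ℕ) : B :=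
  ∑ j ∈ range (d + 1), ∑ i ∈ range (d - j + 1),
    ((-1 : k) ^ ((e' - 1) * dagger p i)) •
      σ.map (d - j + 1) fun t : Fin (d - j + 1) =>
        replaceBlock a i j (τ.map j fun u : Fin j => a (i + u)) t

end Cochains

section Graded

variable {k : Type u} [Field k] {A : Type v} [AddCommGroup A] [Module k A]
  {B : Type w} [AddCommGroup B] [Module k B]

theorem bijective_coe {g : ℤ → Submodule k A} (hg : DirectSum.IsInternal g) :
    Function.Bijective (DirectSum.coeLinearMap g) := hg

/-- The linear endomorphism of a graded vector space multiplying the degree `i` piece by `c i`. -/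
noncomputable def diagonal {g : ℤ → Submodule k A} (hg : DirectSum.IsInternal g) (c : ℤ → k) :
    A →ₗ[k] A :=
  (DirectSum.toModule k ℤ A fun i => c i • (g i).subtype) ∘ₗ
    (LinearEquiv.ofBijective (DirectSum.coeLinearMap g) (bijective_coe hg)).symm.toLinearMap

theorem diagonal_of_mem {g : ℤ → Submodule k A} (hg : DirectSum.IsInternal g) (c : ℤ → k)
    {i : ℤ} {a : A} (ha : a ∈ g i) : diagonal hg c a = c i • a := by
  have h : (LinearEquiv.ofBijective (DirectSum.coeLinearMap g) (bijective_coe hg)).symm a =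
      DirectSum.lof k ℤ (fun i => g i) i ⟨a, ha⟩ := by
    rw [LinearEquiv.symm_apply_eq]
    simp
  simp only [diagonal, LinearMap.comp_apply, LinearEquiv.coe_coe, h, DirectSum.toModule_lof]
  simp

/-- The Euler vector field of a graded vector space: multiplication by `i` in degree `i`. -/
noncomputable def euler {g : ℤ → Submodule k A} (hg : DirectSum.IsInternal g) : A →ₗ[k] A :=
  diagonal hg fun i => (i : k)

theorem euler_of_mem {g : ℤ → Submodule k A} (hg : DirectSum.IsInternal g)
    {i : ℤ} {a : A} (ha : a ∈ g i) : euler hg a = (i : k) • a :=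
  diagonal_of_mem hg _ ha

/-- Two linear maps that agree on homogeneous elements are equal. -/
theorem linearMap_ext {g : ℤ → Submodule k A} (hg : DirectSum.IsInternal g) {f f' : A →ₗ[k] B}
    (h : ∀ i, ∀ a ∈ g i, f a = f' a) : f = f' := by
  ext a
  have ha : a ∈ ⨆ i, g i := by rw [hg.submodule_iSup_eq_top]; trivial
  induction ha using Submodule.iSup_induction' with
  | mem i x hx => exact h i x hx
  | zero => simp
  | add x y _ _ hx hy => simp [hx, hy]

/-- A submodule stable under all homogeneous projections is spanned by its homogeneous elements. -/
theorem mem_iSup_inf {g : ℤ → Submodule k A} (hg : DirectSum.IsInternal g) (N : Submodule k A)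
    (hN : ∀ i, ∀ a ∈ N, diagonal hg (Pi.single i 1) a ∈ N) {a : A} (ha : a ∈ N) :
    a ∈ ⨆ i, g i ⊓ N := by
  classical
  let _ := hg.chooseDecomposition
  have key : ∀ i (x : A), diagonal hg (Pi.single i 1) x = (DirectSum.decompose g x i : A) := by
    intro i x
    have hx : x ∈ ⨆ i, g i := by rw [hg.submodule_iSup_eq_top]; trivial
    induction hx using Submodule.iSup_induction' with
    | mem j x hx =>
      rw [diagonal_of_mem hg _ hx]
      by_cases hij : j = i
      · subst hij
        rw [DirectSum.decompose_of_mem_same _ hx]; simp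
      · rw [DirectSum.decompose_of_mem_ne _ hx hij]; simp [hij]
    | zero => simp
    | add x y _ _ hx hy => simp [hx, hy]
  rw [← DirectSum.sum_support_decompose g a]
  refine Submodule.sum_mem _ fun i _ => Submodule.mem_iSup_of_mem i ⟨SetLike.coe_mem _, ?_⟩
  rw [← key]
  exact hN i a ha

end Graded

/-- A `ℤ`-graded (not necessarily unital) `A∞`-algebra structure over `k` on a vector space `A`:
a decomposition `A = ⨁ᵢ Aⁱ` and operations `μ^d : A^{⊗ d} → A`, `d ≥ 1`, of degree `2 - d`,
with `μ ∘ μ = 0`. -/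
structure AInfAlgebra (k : Type u) [Field k] (A : Type v) [AddCommGroup A] [Module k A] where
  gr : ℤ → Submodule k A
  gr_internal : DirectSum.IsInternal gr
  μ : Cochain gr gr 2
  μ_zero : μ.map 0 = 0
  relation : ∀ (p : ℕ → ℤ) (a : ℕ → A), (∀ t, a t ∈ gr (p t)) →
    ∀ d, convolution μ μ p a d = 0

section Differential

variable {k : Type u} [Field k] {A : Type v} [AddCommGroup A] [Module k A]
  {B : Type w} [AddCommGroup B] [Module k B]

theorem map_replaceBlock_zero {gA : ℤ → Submodule k A} {gB : ℤ → Submodule k B} {e : ℤ}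
    (σ : Cochain gA gB e) (a : ℕ → A) (i j n : ℕ) (h : i < n) :
    (σ.map n fun t : Fin n => replaceBlock a i j 0 t) = 0 :=
  MultilinearMap.map_coord_zero _ ⟨i, h⟩ (by simp [replaceBlock])

/-- The convolution of order one when `τ⁰ = 0`. -/
theorem convolution_one {gA : ℤ → Submodule k A} {gB : ℤ → Submodule k B} {e e' : ℤ}
    (σ : Cochain gA gB e) (τ : Cochain gA gA e') (h0 : τ.map 0 = 0) (p : ℕ → ℤ) (a : ℕ → A) :
    convolution σ τ p a 1 = σ.linear (τ.linear (a 0)) := by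
  rw [convolution, Finset.sum_range_succ, Finset.sum_range_succ]
  have h1 : ∀ x : A, (σ.map 1 fun t : Fin 1 => replaceBlock a 0 1 x t) = σ.linear x := by
    intro x
    simp only [Cochain.linear, MultilinearMap.ofSubsingleton_symm_apply_apply]
    congr 1
    ext t
    simp [replaceBlock, Subsingleton.elim t 0]
  have h2 : (τ.map 1 fun u : Fin 1 => a (0 + u)) = τ.linear (a 0) := by
    simp only [Cochain.linear, MultilinearMap.ofSubsingleton_symm_apply_apply]
    congr 1
    ext t
    simp [Subsingleton.elim t 0]
  have h3 : ∀ i ∈ range (1 - 0 + 1), ((-1 : k) ^ ((e' - 1) * dagger p i)) •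
      (σ.map (1 - 0 + 1) fun t : Fin (1 - 0 + 1) =>
        replaceBlock a i 0 (τ.map 0 fun u : Fin 0 => a (i + u)) t) = 0 := by
    intro i hi
    rw [h0, _root_.zero_apply, map_replaceBlock_zero _ _ _ _ _ (Finset.mem_range.1 hi),
      smul_zero]
  simp only [Finset.range_zero, Finset.sum_empty, zero_add]
  rw [Finset.sum_eq_zero h3, zero_add]
  rw [Nat.sub_self, Finset.sum_range_one, h2]
  erw [h1]
  simp [dagger]

end Differential

namespace AInfAlgebra

variable {k : Type u} [Field k] {A : Type v} [AddCommGroup A] [Module k A]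
  {B : Type w} [AddCommGroup B] [Module k B]

/-- The differential `μ¹`. -/
def d (𝓐 : AInfAlgebra k A) : A →ₗ[k] A := 𝓐.μ.linear

theorem d_mem (𝓐 : AInfAlgebra k A) {i : ℤ} {a : A} (ha : a ∈ 𝓐.gr i) : 𝓐.d a ∈ 𝓐.gr (i + 1) := by
  have h := 𝓐.μ.map_mem 1 (fun _ => i) (fun _ => a) fun _ => ha
  have e : (∑ _j : Fin 1, (i - 1)) + 2 = i + 1 := by simp; ring
  rw [e] at h
  exact h

theorem d_d (𝓐 : AInfAlgebra k A) (a : A) : 𝓐.d (𝓐.d a) = 0 := by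
  have : 𝓐.d ∘ₗ 𝓐.d = 0 := linearMap_ext 𝓐.gr_internal fun i a ha => by
    have h := 𝓐.relation (fun _ => i) (fun _ => a) (fun _ => ha) 1
    rw [convolution_one _ _ 𝓐.μ_zero] at h
    exact h
  exact LinearMap.congr_fun this a

/-- The coboundaries, inside the space of cocycles. -/
def boundaries (𝓐 : AInfAlgebra k A) : Submodule k (LinearMap.ker 𝓐.d) :=
  (LinearMap.range 𝓐.d).comap (LinearMap.ker 𝓐.d).subtype

/-- The cohomology `H(𝓐) = ker μ¹ / im μ¹`. -/
abbrev Cohomology (𝓐 : AInfAlgebra k A) : Type v := LinearMap.ker 𝓐.d ⧸ 𝓐.boundaries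

/-- The class of a cocycle. -/
def cls (𝓐 : AInfAlgebra k A) : LinearMap.ker 𝓐.d →ₗ[k] 𝓐.Cohomology := 𝓐.boundaries.mkQ

theorem cls_surjective (𝓐 : AInfAlgebra k A) : Function.Surjective 𝓐.cls :=
  Submodule.mkQ_surjective _

theorem cls_eq_zero (𝓐 : AInfAlgebra k A) (z : LinearMap.ker 𝓐.d) :
    𝓐.cls z = 0 ↔ ∃ y, 𝓐.d y = z := by
  rw [cls, Submodule.mkQ_apply, Submodule.Quotient.mk_eq_zero]
  rfl

/-- The map on cohomology induced by a linear map that preserves cocycles and coboundaries. -/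
def cohomologyMap (𝓐 : AInfAlgebra k A) (𝓑 : AInfAlgebra k B) (f : A →ₗ[k] B)
    (hk : ∀ x, 𝓐.d x = 0 → 𝓑.d (f x) = 0) (hr : ∀ x, ∃ y, 𝓑.d y = f (𝓐.d x)) :
    𝓐.Cohomology →ₗ[k] 𝓑.Cohomology :=
  Submodule.mapQ _ _ (f.restrict (p := LinearMap.ker 𝓐.d) (q := LinearMap.ker 𝓑.d) hk) <| by
    rintro ⟨x, hx⟩ ⟨y, hy⟩
    obtain ⟨z, hz⟩ := hr y
    exact ⟨z, by rw [hz, hy]; rfl⟩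

theorem cohomologyMap_cls (𝓐 : AInfAlgebra k A) (𝓑 : AInfAlgebra k B) (f : A →ₗ[k] B)
    (hk : ∀ x, 𝓐.d x = 0 → 𝓑.d (f x) = 0) (hr : ∀ x, ∃ y, 𝓑.d y = f (𝓐.d x))
    (z : LinearMap.ker 𝓐.d) :
    𝓐.cohomologyMap 𝓑 f hk hr (𝓐.cls z) = 𝓑.cls ⟨f z, hk z z.2⟩ := rfl

/-- The grading of cohomology: `Hⁱ` consists of the classes of cocycles of degree `i`. -/
def cohomologyGr (𝓐 : AInfAlgebra k A) (i : ℤ) : Submodule k 𝓐.Cohomology :=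
  ((𝓐.gr i).comap (LinearMap.ker 𝓐.d).subtype).map 𝓐.cls

theorem d_diagonal (𝓐 : AInfAlgebra k A) (i : ℤ) (a : A) :
    𝓐.d (diagonal 𝓐.gr_internal (Pi.single i 1) a) =
      diagonal 𝓐.gr_internal (Pi.single (i + 1) 1) (𝓐.d a) := by
  have : 𝓐.d ∘ₗ diagonal 𝓐.gr_internal (Pi.single i 1) =
      diagonal 𝓐.gr_internal (Pi.single (i + 1) 1) ∘ₗ 𝓐.d :=
    linearMap_ext 𝓐.gr_internal fun j a ha => by
      simp only [LinearMap.comp_apply]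
      rw [diagonal_of_mem _ _ ha, diagonal_of_mem _ _ (𝓐.d_mem ha), map_smul]
      simp [Pi.single_apply]
  exact LinearMap.congr_fun this a

/-- Every cocycle is a sum of homogeneous cocycles. -/
theorem cocycle_mem (𝓐 : AInfAlgebra k A) {a : A} (ha : 𝓐.d a = 0) :
    a ∈ ⨆ i, 𝓐.gr i ⊓ LinearMap.ker 𝓐.d :=
  mem_iSup_inf 𝓐.gr_internal _ (fun i x hx => by
    rw [LinearMap.mem_ker] at hx ⊢
    rw [d_diagonal, hx, map_zero]) ha

theorem cohomologyGr_internal (𝓐 : AInfAlgebra k A) : DirectSum.IsInternal 𝓐.cohomologyGr := by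
  rw [DirectSum.isInternal_submodule_iff_iSupIndep_and_iSup_eq_top]
  constructor
  · intro i
    rw [Submodule.disjoint_def]
    intro x hx hx'
    set P : 𝓐.Cohomology →ₗ[k] 𝓐.Cohomology :=
      𝓐.cohomologyMap 𝓐 (diagonal 𝓐.gr_internal (Pi.single i 1))
        (fun x hx => by rw [d_diagonal, hx, map_zero])
        (fun x => ⟨diagonal 𝓐.gr_internal (Pi.single (i - 1) 1) x, by
          rw [d_diagonal, sub_add_cancel]⟩) with hP
    have hsame : ∀ y ∈ 𝓐.cohomologyGr i, P y = y := by
      rintro _ ⟨z, hz, rfl⟩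
      rw [hP, cohomologyMap_cls]
      congr 1
      apply Subtype.ext
      change diagonal 𝓐.gr_internal (Pi.single i 1) (z : A) = z
      rw [diagonal_of_mem _ _ (show (z : A) ∈ 𝓐.gr i from hz)]
      simp
    have hne : (⨆ j, ⨆ (_ : j ≠ i), 𝓐.cohomologyGr j) ≤ LinearMap.ker P := by
      refine iSup₂_le fun j hj => ?_
      rintro _ ⟨z, hz, rfl⟩
      rw [LinearMap.mem_ker, hP, cohomologyMap_cls, cls_eq_zero]
      refine ⟨0, ?_⟩
      change 𝓐.d 0 = diagonal 𝓐.gr_internal (Pi.single i 1) (z : A)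
      rw [diagonal_of_mem _ _ (show (z : A) ∈ 𝓐.gr j from hz)]
      simp [hj]
    rw [← hsame x hx]
    exact hne hx'
  · rw [eq_top_iff]
    rintro x -
    obtain ⟨⟨z, hz⟩, rfl⟩ := 𝓐.cls_surjective x
    have key : ∀ (y : A), y ∈ (⨆ i, 𝓐.gr i ⊓ LinearMap.ker 𝓐.d) → ∀ hy : 𝓐.d y = 0,
        𝓐.cls ⟨y, hy⟩ ∈ ⨆ i, 𝓐.cohomologyGr i := by
      intro y hy
      induction hy using Submodule.iSup_induction' with
      | mem i x hx => exact fun h => Submodule.mem_iSup_of_mem i ⟨⟨x, h⟩, hx.1, rfl⟩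
      | zero =>
        intro h
        have : (⟨0, h⟩ : LinearMap.ker 𝓐.d) = 0 := rfl
        rw [this, map_zero]
        exact Submodule.zero_mem _
      | add x y hx hy ihx ihy =>
        intro h
        have hk : (⨆ i, 𝓐.gr i ⊓ LinearMap.ker 𝓐.d) ≤ LinearMap.ker 𝓐.d :=
          iSup_le fun i => inf_le_right
        exact Submodule.add_mem _ (ihx (hk hx)) (ihy (hk hy))
    exact key z (𝓐.cocycle_mem hz) hz

theorem update_one {X : Type*} (x y z : X) : Function.update ![x, y] 1 z = ![x, z] := by
  ext t; fin_cases t <;> rfl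

theorem update_zero {X : Type*} (x y z : X) : Function.update ![x, y] 0 z = ![z, y] := by
  ext t; fin_cases t <;> rfl

/-- The product `μ²` as a bilinear map: `mul a₂ a₁ = μ²(a₂, a₁)`. -/
def mul (𝓐 : AInfAlgebra k A) : A →ₗ[k] A →ₗ[k] A :=
  LinearMap.mk₂ k (fun a₂ a₁ => 𝓐.μ.map 2 ![a₁, a₂])
    (fun x y z => by
      have h := (𝓐.μ.map 2).map_update_add ![z, x] 1 x y
      rwa [update_one, update_one, update_one] at h)
    (fun c x z => by
      have h := (𝓐.μ.map 2).map_update_smul ![z, x] 1 c x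
      rwa [update_one, update_one] at h)
    (fun z x y => by
      have h := (𝓐.μ.map 2).map_update_add ![x, z] 0 x y
      rwa [update_zero, update_zero, update_zero] at h)
    (fun c z x => by
      have h := (𝓐.μ.map 2).map_update_smul ![x, z] 0 c x
      rwa [update_zero, update_zero] at h)

theorem mul_apply (𝓐 : AInfAlgebra k A) (a₂ a₁ : A) : 𝓐.mul a₂ a₁ = 𝓐.μ.map 2 ![a₁, a₂] := rfl

theorem mul_mem (𝓐 : AInfAlgebra k A) {i₂ i₁ : ℤ} {a₂ a₁ : A} (h₂ : a₂ ∈ 𝓐.gr i₂)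
    (h₁ : a₁ ∈ 𝓐.gr i₁) : 𝓐.mul a₂ a₁ ∈ 𝓐.gr (i₂ + i₁) := by
  have h := 𝓐.μ.map_mem 2 ![i₁, i₂] ![a₁, a₂] (by
    intro i; fin_cases i <;> simpa)
  have e : (∑ j : Fin 2, (![i₁, i₂] j - 1)) + 2 = i₂ + i₁ := by
    simp [Fin.sum_univ_two]; ring
  rw [e] at h
  exact h

theorem convolution_two {gA : ℤ → Submodule k A} {e e' : ℤ}
    (σ : Cochain gA gA e) (τ : Cochain gA gA e') (h0 : τ.map 0 = 0) (p : ℕ → ℤ) (a : ℕ → A) :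
    convolution σ τ p a 2 = σ.map 2 ![τ.linear (a 0), a 1] +
      ((-1 : k) ^ ((e' - 1) * (p 0 - 1))) • σ.map 2 ![a 0, τ.linear (a 1)] +
      σ.linear (τ.map 2 ![a 0, a 1]) := by
  have h3 : ∀ i ∈ range 3, ((-1 : k) ^ ((e' - 1) * dagger p i)) •
      (σ.map 3 fun t : Fin 3 =>
        replaceBlock a i 0 (τ.map 0 fun u : Fin 0 => a (i + u)) t) = 0 := by
    intro i hi
    rw [h0, _root_.zero_apply, map_replaceBlock_zero _ _ _ _ _ (Finset.mem_range.1 hi),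
      smul_zero]
  have hl : ∀ i, (τ.map 1 fun u : Fin 1 => a (i + u)) = τ.linear (a i) := by
    intro i
    simp only [Cochain.linear, MultilinearMap.ofSubsingleton_symm_apply_apply]
    congr 1
    ext t
    simp [Subsingleton.elim t 0]
  have hs : ∀ x : A, (σ.map 1 fun t : Fin 1 => replaceBlock a 0 2 x t) = σ.linear x := by
    intro x
    simp only [Cochain.linear, MultilinearMap.ofSubsingleton_symm_apply_apply]
    congr 1
    ext t
    simp [replaceBlock, Subsingleton.elim t 0]
  have h20 : ∀ x : A, (fun t : Fin 2 => replaceBlock a 0 1 x t) = ![x, a 1] := by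
    intro x; ext t; fin_cases t <;> simp [replaceBlock]
  have h21 : ∀ x : A, (fun t : Fin 2 => replaceBlock a 1 1 x t) = ![a 0, x] := by
    intro x; ext t; fin_cases t <;> simp [replaceBlock]
  have ht : (fun u : Fin 2 => a (0 + u)) = ![a 0, a 1] := by
    ext t; fin_cases t <;> simp
  simp only [convolution]
  rw [Finset.sum_range_succ, Finset.sum_range_succ, Finset.sum_range_one]
  have e0 : ∑ i ∈ range (2 - 0 + 1), ((-1 : k) ^ ((e' - 1) * dagger p i)) •
      (σ.map (2 - 0 + 1) fun t : Fin (2 - 0 + 1) =>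
        replaceBlock a i 0 (τ.map 0 fun u : Fin 0 => a (i + u)) t) = 0 := Finset.sum_eq_zero h3
  rw [e0, zero_add]
  simp only [Nat.reduceSub, Nat.reduceAdd]
  rw [Finset.sum_range_succ, Finset.sum_range_one, Finset.sum_range_one, hl, hl, h20, h21, ht]
  erw [hs]
  simp [dagger]

/-- The convolution of order three when `τ⁰ = 0`. -/
theorem convolution_three {gA : ℤ → Submodule k A} {e e' : ℤ}
    (σ : Cochain gA gA e) (τ : Cochain gA gA e') (h0 : τ.map 0 = 0) (p : ℕ → ℤ) (a : ℕ → A)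
    (h1 : ∀ i, τ.linear (a i) = 0) :
    convolution σ τ p a 3 = σ.map 2 ![τ.map 2 ![a 0, a 1], a 2] +
      ((-1 : k) ^ ((e' - 1) * (p 0 - 1))) • σ.map 2 ![a 0, τ.map 2 ![a 1, a 2]] +
      σ.linear (τ.map 3 ![a 0, a 1, a 2]) := by
  have h4 : ∀ i ∈ range 4, ((-1 : k) ^ ((e' - 1) * dagger p i)) •
      (σ.map 4 fun t : Fin 4 =>
        replaceBlock a i 0 (τ.map 0 fun u : Fin 0 => a (i + u)) t) = 0 := by
    intro i hi
    rw [h0, _root_.zero_apply, map_replaceBlock_zero _ _ _ _ _ (Finset.mem_range.1 hi),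
      smul_zero]
  have hl : ∀ i, (τ.map 1 fun u : Fin 1 => a (i + u)) = τ.linear (a i) := by
    intro i
    simp only [Cochain.linear, MultilinearMap.ofSubsingleton_symm_apply_apply]
    congr 1
    ext t
    simp [Subsingleton.elim t 0]
  have h3 : ∀ i ∈ range 3, ((-1 : k) ^ ((e' - 1) * dagger p i)) •
      (σ.map 3 fun t : Fin 3 =>
        replaceBlock a i 1 (τ.map 1 fun u : Fin 1 => a (i + u)) t) = 0 := by
    intro i hi
    rw [hl, h1, map_replaceBlock_zero _ _ _ _ _ (Finset.mem_range.1 hi), smul_zero]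
  have hs : ∀ x : A, (σ.map 1 fun t : Fin 1 => replaceBlock a 0 3 x t) = σ.linear x := by
    intro x
    simp only [Cochain.linear, MultilinearMap.ofSubsingleton_symm_apply_apply]
    congr 1
    ext t
    simp [replaceBlock, Subsingleton.elim t 0]
  have h20 : ∀ x : A, (fun t : Fin 2 => replaceBlock a 0 2 x t) = ![x, a 2] := by
    intro x; ext t; fin_cases t <;> simp [replaceBlock]
  have h21 : ∀ x : A, (fun t : Fin 2 => replaceBlock a 1 2 x t) = ![a 0, x] := by
    intro x; ext t; fin_cases t <;> simp [replaceBlock]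
  have ht0 : (fun u : Fin 2 => a (0 + u)) = ![a 0, a 1] := by
    ext t; fin_cases t <;> simp
  have ht1 : (fun u : Fin 2 => a (1 + u)) = ![a 1, a 2] := by
    ext t; fin_cases t <;> simp
  have ht : (fun u : Fin 3 => a (0 + u)) = ![a 0, a 1, a 2] := by
    ext t; fin_cases t <;> simp
  simp only [convolution]
  rw [Finset.sum_range_succ, Finset.sum_range_succ, Finset.sum_range_succ, Finset.sum_range_one]
  have e0 : ∑ i ∈ range (3 - 0 + 1), ((-1 : k) ^ ((e' - 1) * dagger p i)) •
      (σ.map (3 - 0 + 1) fun t : Fin (3 - 0 + 1) =>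
        replaceBlock a i 0 (τ.map 0 fun u : Fin 0 => a (i + u)) t) = 0 := Finset.sum_eq_zero h4
  have e1 : ∑ i ∈ range (3 - 1 + 1), ((-1 : k) ^ ((e' - 1) * dagger p i)) •
      (σ.map (3 - 1 + 1) fun t : Fin (3 - 1 + 1) =>
        replaceBlock a i 1 (τ.map 1 fun u : Fin 1 => a (i + u)) t) = 0 := Finset.sum_eq_zero h3
  rw [e0, e1, zero_add, zero_add]
  simp only [Nat.reduceSub, Nat.reduceAdd]
  rw [Finset.sum_range_succ, Finset.sum_range_one, Finset.sum_range_one, h20, h21, ht0, ht1, ht]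
  erw [hs]
  simp [dagger]

/-- The Leibniz equation. -/
theorem leibniz (𝓐 : AInfAlgebra k A) {i₂ i₁ : ℤ} {a₂ a₁ : A} (h₂ : a₂ ∈ 𝓐.gr i₂)
    (h₁ : a₁ ∈ 𝓐.gr i₁) :
    𝓐.d (𝓐.mul a₂ a₁) + 𝓐.mul a₂ (𝓐.d a₁) +
      ((-1 : k) ^ (i₁ - 1)) • 𝓐.mul (𝓐.d a₂) a₁ = 0 := by
  have h := 𝓐.relation (fun t => if t = 0 then i₁ else if t = 1 then i₂ else 0)
    (fun t => if t = 0 then a₁ else if t = 1 then a₂ else 0)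
    (fun t => by
      by_cases h0 : t = 0
      · simpa [h0]
      · by_cases h1 : t = 1
        · simpa [h1]
        · simp [h0, h1]) 2
  rw [convolution_two _ _ 𝓐.μ_zero] at h
  simp only [mul_apply, d]
  simp at h
  rw [← h]
  abel

theorem mul_cocycle (𝓐 : AInfAlgebra k A) {x y : A} (hx : 𝓐.d x = 0) (hy : 𝓐.d y = 0) :
    𝓐.d (𝓐.mul x y) = 0 := by
  have h1 : ∀ i, ∀ y ∈ 𝓐.gr i, 𝓐.d y = 0 → 𝓐.d (𝓐.mul x y) = 0 := by
    intro i y hyi hy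
    have hx' := 𝓐.cocycle_mem hx
    clear hx
    induction hx' using Submodule.iSup_induction' with
    | mem j x hx =>
      have h := 𝓐.leibniz hx.1 hyi
      rw [hy, LinearMap.mem_ker.1 hx.2] at h
      simpa using h
    | zero => simp
    | add x x' h h' ih ih' =>
      rw [map_add, LinearMap.add_apply, map_add, ih, ih', add_zero]
  have hy' := 𝓐.cocycle_mem hy
  clear hy
  induction hy' using Submodule.iSup_induction' with
  | mem j y hy => exact h1 j y hy.1 hy.2
  | zero => simp
  | add x x' h h' ih ih' =>
    rw [map_add, map_add, ih, ih', add_zero]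

theorem mul_boundary_left (𝓐 : AInfAlgebra k A) (w : A) {y : A} (hy : 𝓐.d y = 0) :
    ∃ v, 𝓐.d v = 𝓐.mul (𝓐.d w) y := by
  have hw : w ∈ ⨆ i, 𝓐.gr i := by rw [𝓐.gr_internal.submodule_iSup_eq_top]; trivial
  have hy' := 𝓐.cocycle_mem hy
  clear hy
  change 𝓐.mul (𝓐.d w) y ∈ LinearMap.range 𝓐.d
  induction hw using Submodule.iSup_induction' with
  | mem i w hw =>
    induction hy' using Submodule.iSup_induction' with
    | mem j y hy =>
      have h := 𝓐.leibniz hw hy.1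
      rw [LinearMap.mem_ker.1 hy.2, map_zero, add_zero] at h
      have hs : ((-1 : k) ^ (j - 1)) ≠ 0 := zpow_ne_zero _ (by simp)
      refine ⟨-(((-1 : k) ^ (j - 1))⁻¹ • 𝓐.mul w y), ?_⟩
      rw [map_neg, map_smul, eq_neg_of_add_eq_zero_left h, smul_neg, neg_neg, smul_smul,
        inv_mul_cancel₀ hs, one_smul]
    | zero => simp
    | add y y' _ _ ih ih' => rw [map_add]; exact Submodule.add_mem _ ih ih'
  | zero => simp
  | add w w' _ _ ih ih' =>
    rw [map_add, map_add, LinearMap.add_apply]; exact Submodule.add_mem _ ih ih'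

theorem mul_boundary_right (𝓐 : AInfAlgebra k A) {x : A} (w : A) (hx : 𝓐.d x = 0) :
    ∃ v, 𝓐.d v = 𝓐.mul x (𝓐.d w) := by
  have hw : w ∈ ⨆ i, 𝓐.gr i := by rw [𝓐.gr_internal.submodule_iSup_eq_top]; trivial
  have hx' := 𝓐.cocycle_mem hx
  clear hx
  change 𝓐.mul x (𝓐.d w) ∈ LinearMap.range 𝓐.d
  induction hw using Submodule.iSup_induction' with
  | mem i w hw =>
    induction hx' using Submodule.iSup_induction' with
    | mem j x hx =>
      have h := 𝓐.leibniz hx.1 hw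
      rw [LinearMap.mem_ker.1 hx.2, map_zero, LinearMap.zero_apply, smul_zero, add_zero] at h
      exact ⟨-𝓐.mul x w, by rw [map_neg, eq_neg_of_add_eq_zero_left h, neg_neg]⟩
    | zero => simp
    | add y y' _ _ ih ih' =>
      rw [map_add, LinearMap.add_apply]; exact Submodule.add_mem _ ih ih'
  | zero => simp
  | add w w' _ _ ih ih' =>
    rw [map_add, map_add]; exact Submodule.add_mem _ ih ih'

/-- The product of two cocycles, as a cohomology class. -/
def cocycleMul (𝓐 : AInfAlgebra k A) :
    LinearMap.ker 𝓐.d →ₗ[k] LinearMap.ker 𝓐.d →ₗ[k] 𝓐.Cohomology :=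
  LinearMap.mk₂ k (fun x y => 𝓐.cls ⟨𝓐.mul x y, 𝓐.mul_cocycle x.2 y.2⟩)
    (fun x y z => by
      rw [← map_add]; congr 1; apply Subtype.ext; simp)
    (fun c x z => by
      rw [← map_smul]; congr 1; apply Subtype.ext; simp)
    (fun x y z => by
      rw [← map_add]; congr 1; apply Subtype.ext; simp)
    (fun c x z => by
      rw [← map_smul]; congr 1; apply Subtype.ext; simp)

/-- The product on cohomology induced by `μ²`, as a bilinear map. -/
def cohomologyMul (𝓐 : AInfAlgebra k A) :
    𝓐.Cohomology →ₗ[k] 𝓐.Cohomology →ₗ[k] 𝓐.Cohomology :=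
  (Submodule.liftQ 𝓐.boundaries
    (Submodule.liftQ 𝓐.boundaries 𝓐.cocycleMul (by
      rintro ⟨x, hx⟩ ⟨w, hw⟩
      ext y
      obtain ⟨v, hv⟩ := 𝓐.mul_boundary_left w y.2
      exact (𝓐.cls_eq_zero _).2 ⟨v, by rw [hv, hw]; rfl⟩)).flip (by
    rintro ⟨y, hy⟩ ⟨w, hw⟩
    ext x
    obtain ⟨v, hv⟩ := 𝓐.mul_boundary_right w x.2
    exact (𝓐.cls_eq_zero _).2 ⟨v, by rw [hv, hw]; rfl⟩)).flip

/-- `[x] · [y] = [μ²(x, y)]`. -/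
theorem cohomologyMul_cls (𝓐 : AInfAlgebra k A) (x y : LinearMap.ker 𝓐.d) :
    𝓐.cohomologyMul (𝓐.cls x) (𝓐.cls y) =
      𝓐.cls ⟨𝓐.mul x y, 𝓐.mul_cocycle x.2 y.2⟩ := rfl

/-- The operations on cohomology: all vanish except
`μ²([a₂], [a₁]) = [μ²(a₂, a₁)]`. -/
def cohomologyOps (𝓐 : AInfAlgebra k A) :
    (s : ℕ) → MultilinearMap k (fun _ : Fin s => 𝓐.Cohomology) 𝓐.Cohomology
  | 2 => MultilinearMap.mk' (fun x => 𝓐.cohomologyMul (x 1) (x 0))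
      (fun m i x y => by fin_cases i <;> simp)
      (fun m i c x => by fin_cases i <;> simp)
  | _ => 0

theorem cohomologyOps_two (𝓐 : AInfAlgebra k A) (x : Fin 2 → 𝓐.Cohomology) :
    𝓐.cohomologyOps 2 x = 𝓐.cohomologyMul (x 1) (x 0) := rfl

theorem cohomologyOps_ne (𝓐 : AInfAlgebra k A) {s : ℕ} (hs : s ≠ 2) :
    𝓐.cohomologyOps s = 0 := by
  unfold cohomologyOps
  split
  · exact absurd rfl hs
  · rfl

/-- The operations on cohomology as a Hochschild cochain of degree two. -/
def cohomologyμ (𝓐 : AInfAlgebra k A) : Cochain 𝓐.cohomologyGr 𝓐.cohomologyGr 2 where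
  map := 𝓐.cohomologyOps
  map_mem s p a ha := by
    by_cases hs : s = 2
    · subst hs
      obtain ⟨x, hx, hx'⟩ := ha 0
      obtain ⟨y, hy, hy'⟩ := ha 1
      rw [cohomologyOps_two, ← hx', ← hy', cohomologyMul_cls]
      refine ⟨_, ?_, rfl⟩
      have h := 𝓐.mul_mem (show (y : A) ∈ 𝓐.gr (p 1) from hy) (show (x : A) ∈ 𝓐.gr (p 0) from hx)
      have e : (∑ i, (p i - 1)) + 2 = p 1 + p 0 := by
        rw [Fin.sum_univ_two]; ring
      rw [e]
      exact h
    · rw [cohomologyOps_ne 𝓐 hs]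
      exact Submodule.zero_mem _

/-- The cohomology algebra `H(𝓐)`, as an `A∞`-algebra whose only operation is the product. -/
def cohomologyAlgebra (𝓐 : AInfAlgebra k A) : AInfAlgebra k 𝓐.Cohomology where
  gr := 𝓐.cohomologyGr
  gr_internal := 𝓐.cohomologyGr_internal
  μ := 𝓐.cohomologyμ
  μ_zero := 𝓐.cohomologyOps_ne (by norm_num)
  relation p a ha n := by
    have hz : ∀ s, s ≠ 2 → 𝓐.cohomologyμ.map s = 0 := fun s hs => 𝓐.cohomologyOps_ne hs
    by_cases hn : n = 3
    · subst hn
      have hlin : 𝓐.cohomologyμ.linear = 0 := by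
        unfold Cochain.linear
        rw [hz 1 (by norm_num)]
        rfl
      rw [convolution_three _ _ (hz 0 (by norm_num)) _ _ (fun i => by rw [hlin]; rfl), hlin]
      choose z hzg hza using ha
      have hza : a = fun t => 𝓐.cls (z t) := funext fun t => (hza t).symm
      have h := 𝓐.relation p (fun t => z t) hzg 3
      rw [convolution_three _ _ 𝓐.μ_zero _ _ (fun i => (z i).2)] at h
      have h2 : ∀ x y, 𝓐.cohomologyμ.map 2 ![x, y] = 𝓐.cohomologyMul y x := fun x y => rfl
      simp only [hza, h2, cohomologyMul_cls]
      rw [LinearMap.zero_apply, add_zero, ← map_smul, ← map_add, cls_eq_zero]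
      refine ⟨-(𝓐.μ.map 3 ![(z 0 : A), z 1, z 2]), ?_⟩
      rw [map_neg]
      exact (eq_neg_of_add_eq_zero_left h).symm
    · refine Finset.sum_eq_zero fun j hj => Finset.sum_eq_zero fun i _ => ?_
      by_cases hj2 : j = 2
      · have : n - j + 1 ≠ 2 := by have := Finset.mem_range.1 hj; omega
        rw [hz _ this, _root_.zero_apply, smul_zero]
      · rename_i hi
        rw [hz _ hj2, _root_.zero_apply,
          map_replaceBlock_zero _ _ _ _ _ (Finset.mem_range.1 hi), smul_zero]

/-- The value on a word `a_d, …, a_1` of the Hochschild differential of `σ ∈ CC^e(𝓐, 𝓐)`,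
`(δσ)^d(a_d, …, a_1)
  = ∑_{i,j} (-1)^{(|σ|-1) †_i} μ^{d-j+1}(a_d, …, σ^j(a_{i+j}, …, a_{i+1}), …, a_1)
  + ∑_{i,j} (-1)^{|σ| + †_i} σ^{d-j+1}(a_d, …, μ^j(a_{i+j}, …, a_{i+1}), …, a_1)`. -/
def hochschildDifferential (𝓐 : AInfAlgebra k A) {e : ℤ} (σ : Cochain 𝓐.gr 𝓐.gr e)
    (p : ℕ → ℤ) (a : ℕ → A) (d : ℕ) : A :=
  convolution 𝓐.μ σ p a d + ((-1 : k) ^ e) • convolution σ 𝓐.μ p a d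

/-- `δσ = 0`; by multilinearity it suffices to require this on homogeneous words. -/
def IsCocycle (𝓐 : AInfAlgebra k A) {e : ℤ} (σ : Cochain 𝓐.gr 𝓐.gr e) : Prop :=
  ∀ (p : ℕ → ℤ) (a : ℕ → A), (∀ t, a t ∈ 𝓐.gr (p t)) →
    ∀ d, 𝓐.hochschildDifferential σ p a d = 0

/-- An **nc**-vector field: a cocycle in `CC¹(𝓐, 𝓐)`. -/
structure NcVectorField (𝓐 : AInfAlgebra k A) where
  cochain : Cochain 𝓐.gr 𝓐.gr 1
  isCocycle : 𝓐.IsCocycle cochain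

theorem NcVectorField.comm_d {𝓐 : AInfAlgebra k A} (b : 𝓐.NcVectorField)
    (h0 : b.cochain.map 0 = 0) (x : A) :
    𝓐.d (b.cochain.linear x) = b.cochain.linear (𝓐.d x) := by
  have : 𝓐.d ∘ₗ b.cochain.linear = b.cochain.linear ∘ₗ 𝓐.d :=
    linearMap_ext 𝓐.gr_internal fun i a ha => by
      have h := b.isCocycle (fun _ => i) (fun _ => a) (fun _ => ha) 1
      rw [hochschildDifferential, convolution_one _ _ 𝓐.μ_zero, convolution_one _ _ h0,
        zpow_one, neg_smul, one_smul, add_neg_eq_zero] at h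
      exact h
  exact LinearMap.congr_fun this x

/-- If `b⁰ = 0`, then `b¹` is a chain map; this is the induced endomorphism of `H(𝓐)`. -/
def NcVectorField.inducedEnd {𝓐 : AInfAlgebra k A} (b : 𝓐.NcVectorField)
    (h0 : b.cochain.map 0 = 0) : 𝓐.Cohomology →ₗ[k] 𝓐.Cohomology :=
  𝓐.cohomologyMap 𝓐 b.cochain.linear
    (fun x hx => by rw [b.comm_d h0, hx, map_zero])
    (fun x => ⟨b.cochain.linear x, b.comm_d h0 x⟩)

/-- An **nc**-vector field `b` is pure if `b⁰ = 0` and the induced endomorphism of `H(𝓐)` is the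
Euler vector field. -/
def NcVectorField.IsPure {𝓐 : AInfAlgebra k A} (b : 𝓐.NcVectorField) : Prop :=
  ∃ h0 : b.cochain.map 0 = 0, b.inducedEnd h0 = euler 𝓐.cohomologyGr_internal

/-- `𝓐` is pure if it admits a pure **nc**-vector field. -/
def IsPure (𝓐 : AInfAlgebra k A) : Prop := ∃ b : 𝓐.NcVectorField, b.IsPure

/-- An `A∞`-homomorphism `𝓐 → 𝓑`: maps `F^d : A^{⊗ d} → B`, `d ≥ 1`, of degree `1 - d` with
`∑_r ∑_{s_1 + ⋯ + s_r = d} μ_𝓑^r(F^{s_r}(a_d, …), …, F^{s_1}(a_{s_1}, …, a_1))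
  = ∑_{i,j} (-1)^{†_i} F^{d-j+1}(a_d, …, μ_𝓐^j(a_{i+j}, …, a_{i+1}), a_i, …, a_1)`. -/
structure Hom (𝓐 : AInfAlgebra k A) (𝓑 : AInfAlgebra k B) where
  cochain : Cochain 𝓐.gr 𝓑.gr 1
  cochain_zero : cochain.map 0 = 0
  relation : ∀ (p : ℕ → ℤ) (a : ℕ → A), (∀ t, a t ∈ 𝓐.gr (p t)) → ∀ d,
    ∑ c : Composition d, 𝓑.μ.map c.length
        (fun i => cochain.map (c.blocksFun i) fun u => a (c.embedding i u)) =
      convolution cochain 𝓐.μ p a d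

theorem Hom.comm_d {𝓐 : AInfAlgebra k A} {𝓑 : AInfAlgebra k B} (F : Hom 𝓐 𝓑) (x : A) :
    𝓑.d (F.cochain.linear x) = F.cochain.linear (𝓐.d x) := by
  have : 𝓑.d ∘ₗ F.cochain.linear = F.cochain.linear ∘ₗ 𝓐.d :=
    linearMap_ext 𝓐.gr_internal fun i a ha => by
      have h := F.relation (fun _ => i) (fun _ => a) (fun _ => ha) 1
      rw [convolution_one _ _ 𝓐.μ_zero, Fintype.sum_eq_single (Composition.single 1 one_pos)] at h
      · refine Eq.trans ?_ h
        refine congrArg (𝓑.μ.map 1) (funext fun i : Fin 1 => ?_)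
        rw [Subsingleton.elim i 0]
        rfl
      · intro c hc
        refine absurd ((Composition.eq_single_iff_length one_pos).2 ?_) hc
        have h1 := c.length_le
        have h2 := c.length_pos_iff.2 one_pos
        omega
  exact LinearMap.congr_fun this x

/-- The map on cohomology induced by the chain map `F¹`. -/
def Hom.onCohomology {𝓐 : AInfAlgebra k A} {𝓑 : AInfAlgebra k B} (F : Hom 𝓐 𝓑) :
    𝓐.Cohomology →ₗ[k] 𝓑.Cohomology :=
  𝓐.cohomologyMap 𝓑 F.cochain.linear
    (fun x hx => by rw [F.comm_d, hx, map_zero])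
    (fun x => ⟨F.cochain.linear x, F.comm_d x⟩)

/-- `F` is a quasi-isomorphism if it induces an isomorphism on cohomology. -/
def Hom.IsQuasiIso {𝓐 : AInfAlgebra k A} {𝓑 : AInfAlgebra k B} (F : Hom 𝓐 𝓑) : Prop :=
  Function.Bijective F.onCohomology

/-- `𝓐` is quasi-isomorphic to `𝓑` if there is an `A∞`-quasi-isomorphism `𝓐 → 𝓑`. -/
def QuasiIsomorphic (𝓐 : AInfAlgebra k A) (𝓑 : AInfAlgebra k B) : Prop :=
  ∃ F : Hom 𝓐 𝓑, F.IsQuasiIso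

/-- `𝓐` is formal if it is quasi-isomorphic to its cohomology algebra. -/
def IsFormal (𝓐 : AInfAlgebra k A) : Prop := 𝓐.QuasiIsomorphic 𝓐.cohomologyAlgebra

end AInfAlgebra

end AInfinity

/-!
# An `A∞`-algebra over a field of characteristic zero is pure if and only if it is formal

A cochain is treated as a function of words (lists), and `σ ∘ τ` as the result of letting `τ` act on
`σ` by insertion into the word, with the sign operator `a ↦ (-1)^{|a|-1} a` applied to the letters
on which `τ` does not act and which it has to pass. Three facts about this action carry the proof:
it is a derivation with respect to cutting words into two (`insertion_splitSum`), the commutator of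
two insertions is the insertion of the commutator (`insertion_insertion`), and the values on words
of length `n` are governed by the linear parts together with values on shorter words
(`exists_fixedPoint` and the `congr` lemmas). Since `H(𝓐)` has only a product, a homomorphism
`F : 𝓐 → H(𝓐)` is a solution of `F ∘ μ = F · F`, the product being taken over all cuttings of the
word. Throughout, `d = μ¹`, and `s` is a homotopy of degree `-1` with `d s d = d`, `s d s = s`.

*Pure implies formal.* On cochains of degree `e` and arity `n` with values in `H(𝓐)`, commutation
with the Euler fields is multiplication by `e - n` (`euler_apply_of_isHomogeneous`). A pure vector
field `b` is first changed by a coboundary so that `b¹ = euler + s d` (`exists_normalized`); this is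
possible since `b¹ - euler - s d` is a chain map inducing zero on cohomology, hence null-homotopic.
As `s d` is idempotent, on arity `n` the equation `F ∘ b = euler ∘ F` reads
`((n - 1) + E) Fⁿ = (terms of lower arity)`, where `E` is a sum of `n` commuting idempotents, so its
eigenvalues are among `0, …, n`. In characteristic zero the operator is invertible for `n ≥ 2` and
`F` exists, with `F¹` a projection to cohomology. The defect `O = F ∘ μ - F · F` satisfies
`O ∘ b = euler ∘ O` too, but has degree two, so that its lowest term is killed by `(n - 2) + E`.
This is injective for `n ≥ 3`, and for `n ≤ 2` the defect vanishes because the product of `H(𝓐)` is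
induced by `μ²`. Hence `F` is a homomorphism (`exists_square_solution`).

*Formal implies pure.* Given a quasi-isomorphism `F`, the map `a ↦ (F¹ a, s a, s d a)` is injective,
and a cochain `b` is determined by `F ∘ b`, `s ∘ b` and `(s ∘ μ) ∘ b`. One solves
`F ∘ b = euler ∘ F`, `s ∘ b = 0`, `(s ∘ μ) ∘ b = 0` recursively; the commutator of `b` and `μ` is
annihilated by the same three operations, so it is zero (`exists_euler_lift`).
-/

namespace AInfinity

universe u v w x

/-! ### Cutting words -/

section SplitSum

variable {k : Type u} {L : Type v} {W : Type w} [AddCommGroup W] {X : Type x}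

/-- The sum of `g (f v) x` over all ways of cutting a word as `v ++ x`, empty pieces included. -/
def splitSum (g : X → List L → W) : (List L → X) → List L → W
  | f, [] => g (f []) []
  | f, a :: w => g (f []) (a :: w) + splitSum g (fun v => f (a :: v)) w

theorem splitSum_add [Add X] {g : X → List L → W} (hg : ∀ y y' w, g (y + y') w = g y w + g y' w)
    (f f' : List L → X) (w : List L) :
    splitSum g (fun v => f v + f' v) w = splitSum g f w + splitSum g f' w := by
  induction w generalizing f f' with
  | nil => simp [splitSum, hg]
  | cons a w ih => simp only [splitSum, hg, ih]; abel

theorem splitSum_smul [SMul k X] [DistribSMul k W] {g : X → List L → W}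
    (hg : ∀ (c : k) y w, g (c • y) w = c • g y w) (c : k) (f : List L → X) (w : List L) :
    splitSum g (fun v => c • f v) w = c • splitSum g f w := by
  induction w generalizing f with
  | nil => simp [splitSum, hg]
  | cons a w ih => simp only [splitSum, hg, ih, smul_add]

theorem splitSum_zero [Zero X] {g : X → List L → W} (hg : ∀ w, g 0 w = 0) (w : List L) :
    splitSum g (fun _ => 0) w = 0 := by
  induction w with
  | nil => simp [splitSum, hg]
  | cons a w ih => simp only [splitSum, hg, ih, add_zero]

theorem splitSum_add_right (g g' : X → List L → W) (f : List L → X) (w : List L) :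
    splitSum (fun y x => g y x + g' y x) f w = splitSum g f w + splitSum g' f w := by
  induction w generalizing f with
  | nil => simp [splitSum]
  | cons a w ih => simp only [splitSum, ih]; abel

theorem splitSum_smul_right [DistribSMul k W] (c : k) (g : X → List L → W) (f : List L → X)
    (w : List L) :
    splitSum (fun y x => c • g y x) f w = c • splitSum g f w := by
  induction w generalizing f with
  | nil => simp [splitSum]
  | cons a w ih => simp only [splitSum, ih, smul_add]

theorem splitSum_comp [Semiring k] {Y : Type*} [AddCommGroup Y] [Module k W] [Module k Y]
    (φ : W →ₗ[k] Y) (g : X → List L → W) (f : List L → X) (w : List L) :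
    splitSum (fun y x => φ (g y x)) f w = φ (splitSum g f w) := by
  induction w generalizing f with
  | nil => simp [splitSum]
  | cons a w ih => simp only [splitSum, ih, map_add]

theorem splitSum_congr {g g' : X → List L → W} {f f' : List L → X} {w : List L}
    (h : ∀ v x, w = v ++ x → g (f v) x = g' (f' v) x) : splitSum g f w = splitSum g' f' w := by
  induction w generalizing f f' with
  | nil => exact h [] [] rfl
  | cons a w ih =>
    simp only [splitSum]
    rw [h [] (a :: w) rfl, ih fun v x hw => h (a :: v) x (by simp [hw])]

/-- Cutting a word into three pieces: the two ways of iterating a cut agree. -/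
theorem splitSum_splitSum [AddCommGroup X] {Y : Type*} {g : X → List L → W}
    (hg : ∀ y y' w, g (y + y') w = g y w + g y' w) (h : Y → List L → X) (f : List L → Y)
    (w : List L) :
    splitSum (fun y x => splitSum g (h y) x) f w = splitSum g (splitSum h f) w := by
  induction w generalizing f with
  | nil => simp [splitSum]
  | cons a w ih =>
    simp only [splitSum, ih]
    rw [splitSum_add hg]
    abel

end SplitSum

/-! ### Insertion into words -/

section InsertionRec

variable {k : Type u} [Field k] {A : Type v} [AddCommGroup A] [Module k A]
  {W : Type w} [AddCommGroup W]

/-- The sum of `σ (u.map ε ++ τ v :: x)` over all ways of cutting a word as `u ++ v ++ x` with `v`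
nonempty, computed by whether or not `v` starts at the first letter. With `ε` the identity or the
sign operator, according to the parity of `τ`, this is the convolution `σ ∘ τ` if `τ⁰ = 0`. -/
def insertion (ε : A →ₗ[k] A) (τ : List A → A) : (List A → W) → List A → W
  | _, [] => 0
  | σ, a :: w => insertion ε τ (fun x => σ (ε a :: x)) w +
      splitSum (fun y x => σ (y :: x)) (fun v => τ (a :: v)) w

variable (ε : A →ₗ[k] A) (τ : List A → A)

@[simp] theorem insertion_nil (σ : List A → W) : insertion ε τ σ [] = 0 := rfl

theorem insertion_cons (σ : List A → W) (a : A) (w : List A) :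
    insertion ε τ σ (a :: w) = insertion ε τ (fun x => σ (ε a :: x)) w +
      splitSum (fun y x => σ (y :: x)) (fun v => τ (a :: v)) w := rfl

theorem insertion_add (σ σ' : List A → W) (w : List A) :
    insertion ε τ (fun x => σ x + σ' x) w = insertion ε τ σ w + insertion ε τ σ' w := by
  induction w generalizing σ σ' with
  | nil => simp
  | cons a w ih => simp only [insertion_cons, ih, splitSum_add_right]; abel

/-- Insertion is a derivation of cuttings: if a word is cut into `v, x`, the inserted function acts
either on `v` or, with the sign of `v`, on `x`. -/
theorem insertion_splitSum {X : Type*} [AddCommGroup X] {g : X → List A → W}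
    (hg : ∀ y y' w, g (y + y') w = g y w + g y' w) (f : List A → X) (w : List A) :
    insertion ε τ (splitSum g f) w = splitSum g (insertion ε τ f) w +
      splitSum (fun y x => insertion ε τ (g y) x) (fun v => f (v.map ε)) w := by
  have hg0 : ∀ w, g 0 w = 0 := fun w => by simpa using hg 0 0 w
  induction w generalizing f with
  | nil => simp [splitSum, hg0]
  | cons a w ih =>
    simp only [insertion_cons, splitSum, insertion_add, splitSum_add_right, insertion_nil, hg0]
    rw [ih, splitSum_splitSum hg (fun y x => f (y :: x)), splitSum_add hg]
    simp only [List.map_nil, List.map_cons]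
    abel

/-- The value of `σ ∘ τ` on words of length at most `n` depends only on `τ` on such words. -/
theorem insertion_congr_left {τ τ' : List A → A} {σ : List A → W} {n : ℕ}
    (h : ∀ v, v.length ≤ n → τ v = τ' v) {w : List A} (hw : w.length ≤ n) :
    insertion ε τ σ w = insertion ε τ' σ w := by
  induction w generalizing σ with
  | nil => rfl
  | cons a w ih =>
    rw [insertion_cons, insertion_cons, ih (by simp at hw; omega)]
    congr 1
    refine splitSum_congr fun v x hx => ?_
    rw [h]
    rw [hx] at hw
    simp at hw ⊢
    omega

end InsertionRec

/-! ### Multilinear functions of words and the commutator of insertions -/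

section Calculus

variable {k : Type u} [Field k] {A : Type v} [AddCommGroup A] [Module k A]
  {W : Type w} [AddCommGroup W] [Module k W] {X : Type x} [AddCommGroup X] [Module k X]

variable (k) in
/-- A function of words, of arbitrary length, which is linear in each letter. -/
structure IsMultilinear (f : List A → W) : Prop where
  map_add : ∀ (u x : List A) (a b : A), f (u ++ (a + b) :: x) = f (u ++ a :: x) + f (u ++ b :: x)
  map_smul : ∀ (u x : List A) (c : k) (a : A), f (u ++ (c • a) :: x) = c • f (u ++ a :: x)

namespace IsMultilinear

variable {f f' : List A → W}

theorem cons (hf : IsMultilinear k f) (a : A) : IsMultilinear k fun x => f (a :: x) :=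
  ⟨fun u x b c => hf.map_add (a :: u) x b c, fun u x c b => hf.map_smul (a :: u) x c b⟩

theorem cons_add (hf : IsMultilinear k f) (a b : A) (x : List A) :
    f ((a + b) :: x) = f (a :: x) + f (b :: x) := hf.map_add [] x a b

theorem cons_smul (hf : IsMultilinear k f) (c : k) (a : A) (x : List A) :
    f ((c • a) :: x) = c • f (a :: x) := hf.map_smul [] x c a

theorem cons_zero (hf : IsMultilinear k f) (x : List A) : f (0 :: x) = 0 := by
  simpa using hf.cons_smul 0 0 x

theorem cons_sub (hf : IsMultilinear k f) (a b : A) (x : List A) :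
    f ((a - b) :: x) = f (a :: x) - f (b :: x) := by
  rw [eq_sub_iff_add_eq, ← hf.cons_add, sub_add_cancel]

theorem add (hf : IsMultilinear k f) (hf' : IsMultilinear k f') :
    IsMultilinear k (fun w => f w + f' w) :=
  ⟨fun u x a b => by simp only [hf.map_add, hf'.map_add]; abel,
    fun u x c a => by simp only [hf.map_smul, hf'.map_smul, smul_add]⟩

theorem sub (hf : IsMultilinear k f) (hf' : IsMultilinear k f') :
    IsMultilinear k (fun w => f w - f' w) :=
  ⟨fun u x a b => by simp only [hf.map_add, hf'.map_add]; abel,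
    fun u x c a => by simp only [hf.map_smul, hf'.map_smul, smul_sub]⟩

theorem neg (hf : IsMultilinear k f) : IsMultilinear k (fun w => -f w) :=
  ⟨fun u x a b => by simp only [hf.map_add]; abel,
    fun u x c a => by simp only [hf.map_smul, smul_neg]⟩

theorem zero : IsMultilinear k (fun _ : List A => (0 : W)) := ⟨by simp, by simp⟩

theorem smul_length (hf : IsMultilinear k f) (c : ℕ → k) :
    IsMultilinear k (fun w => c w.length • f w) :=
  ⟨fun u x a b => by simp [hf.map_add],
    fun u x c' a => by simp [hf.map_smul, smul_smul, mul_comm]⟩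

theorem comp (hf : IsMultilinear k f) (φ : W →ₗ[k] X) : IsMultilinear k (fun w => φ (f w)) :=
  ⟨fun u x a b => by rw [hf.map_add, _root_.map_add],
    fun u x c a => by rw [hf.map_smul, _root_.map_smul]⟩

theorem comp_map (hf : IsMultilinear k f) (ε : A →ₗ[k] A) :
    IsMultilinear k (fun w => f (w.map ε)) :=
  ⟨fun u x a b => by simp [hf.map_add], fun u x c a => by simp [hf.map_smul]⟩

end IsMultilinear

theorem IsMultilinear.splitSum {g : X → List A → W} {f : List A → X} (hf : IsMultilinear k f)
    (hg : ∀ y, IsMultilinear k (g y)) (hg₁ : ∀ y y' w, g (y + y') w = g y w + g y' w)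
    (hg₂ : ∀ (c : k) y w, g (c • y) w = c • g y w) :
    IsMultilinear k (splitSum g f) := by
  constructor
  · intro u x a b
    induction u generalizing f with
    | nil =>
      simp only [List.nil_append, AInfinity.splitSum, (hg _).cons_add, hf.cons_add]
      rw [splitSum_add hg₁]
      abel
    | cons c u ih =>
      simp only [List.cons_append, AInfinity.splitSum, ih (hf.cons c)]
      rw [← List.cons_append, ← List.cons_append, ← List.cons_append, (hg _).map_add]
      abel
  · intro u x c a
    induction u generalizing f with
    | nil =>
      simp only [List.nil_append, AInfinity.splitSum, (hg _).cons_smul, hf.cons_smul]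
      rw [splitSum_smul hg₂, smul_add]
    | cons b u ih =>
      simp only [List.cons_append, AInfinity.splitSum, ih (hf.cons b), smul_add]
      rw [← List.cons_append, ← List.cons_append, (hg _).map_smul]

section Insertion

variable (ε : A →ₗ[k] A) (τ : List A → A)

theorem insertion_smul (c : k) (σ : List A → W) (w : List A) :
    insertion ε τ (fun x => c • σ x) w = c • insertion ε τ σ w := by
  induction w generalizing σ with
  | nil => simp
  | cons a w ih => simp only [insertion_cons, ih, splitSum_smul_right, smul_add]

theorem insertion_comp (φ : W →ₗ[k] X) (σ : List A → W) (w : List A) :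
    insertion ε τ (fun x => φ (σ x)) w = φ (insertion ε τ σ w) := by
  induction w generalizing σ with
  | nil => simp
  | cons a w ih => simp only [insertion_cons, ih, splitSum_comp, map_add]

theorem insertion_neg (σ : List A → W) (w : List A) :
    insertion ε τ (fun x => - σ x) w = - insertion ε τ σ w := by
  simpa using insertion_smul ε τ (-1 : k) σ w

theorem insertion_sub (σ σ' : List A → W) (w : List A) :
    insertion ε τ (fun x => σ x - σ' x) w = insertion ε τ σ w - insertion ε τ σ' w := by
  simp only [sub_eq_add_neg, insertion_add, insertion_neg]

theorem insertion_zero (w : List A) : insertion ε τ (fun _ => (0 : W)) w = 0 := by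
  simpa using insertion_smul ε τ (0 : k) (fun _ => (0 : W)) w

theorem insertion_add_left {σ : List A → W} (hσ : IsMultilinear k σ) (τ' : List A → A)
    (w : List A) : insertion ε (fun v => τ v + τ' v) σ w =
      insertion ε τ σ w + insertion ε τ' σ w := by
  induction w generalizing σ with
  | nil => simp
  | cons a w ih =>
    simp only [insertion_cons, ih (hσ.cons _)]
    rw [splitSum_add fun y y' w => hσ.cons_add y y' w]
    abel

theorem insertion_smul_left {σ : List A → W} (hσ : IsMultilinear k σ) (c : k)
    (w : List A) : insertion ε (fun v => c • τ v) σ w = c • insertion ε τ σ w := by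
  induction w generalizing σ with
  | nil => simp
  | cons a w ih =>
    simp only [insertion_cons, ih (hσ.cons _)]
    rw [splitSum_smul fun c y w => hσ.cons_smul c y w, smul_add]

theorem insertion_zero_left {σ : List A → W} (hσ : IsMultilinear k σ) (w : List A) :
    insertion ε (fun _ => 0) σ w = 0 := by
  simpa using insertion_smul_left ε (fun _ => 0) hσ 0 w

theorem insertion_sub_left {σ : List A → W} (hσ : IsMultilinear k σ) (τ' : List A → A)
    (w : List A) : insertion ε (fun v => τ v - τ' v) σ w =
      insertion ε τ σ w - insertion ε τ' σ w := by
  have h := insertion_smul_left ε τ' hσ (-1) w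
  have h' := insertion_add_left ε τ hσ (fun v => (-1 : k) • τ' v) w
  simp only [neg_smul, one_smul, ← sub_eq_add_neg] at h h'
  rw [h', h, sub_eq_add_neg]

theorem IsMultilinear.insertion {τ : List A → A} {σ : List A → W} (hτ : IsMultilinear k τ)
    (hσ : IsMultilinear k σ) : IsMultilinear k (insertion ε τ σ) := by
  have key : ∀ {σ : List A → W}, IsMultilinear k σ → ∀ a, IsMultilinear k
      (AInfinity.splitSum (fun y x => σ (y :: x)) fun v => τ (a :: v)) := fun hσ a =>
    (hτ.cons a).splitSum (fun y => hσ.cons y) (fun y y' w => hσ.cons_add y y' w)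
      (fun c y w => hσ.cons_smul c y w)
  constructor
  · intro u x a b
    induction u generalizing σ with
    | nil =>
      simp only [List.nil_append, insertion_cons, _root_.map_add, hσ.cons_add, hτ.cons_add]
      rw [insertion_add, splitSum_add fun y y' w => hσ.cons_add y y' w]
      abel
    | cons c u ih =>
      simp only [List.cons_append, insertion_cons, ih (hσ.cons _), (key hσ c).map_add]
      abel
  · intro u x c a
    induction u generalizing σ with
    | nil =>
      simp only [List.nil_append, insertion_cons, _root_.map_smul, hσ.cons_smul, hτ.cons_smul]
      rw [insertion_smul, splitSum_smul fun c y w => hσ.cons_smul c y w, smul_add]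
    | cons b u ih =>
      simp only [List.cons_append, insertion_cons, ih (hσ.cons _), (key hσ b).map_smul, smul_add]

/-- The commutator of two insertions is the insertion of the commutator (the pre-Lie identity of the
convolution): insertions at disjoint places cancel. Here `η` is `-1` if both functions are odd and
`1` otherwise, and `h₁`, `h₂` express the parity of the inserted functions. -/
theorem insertion_insertion {ε₁ ε₂ : A →ₗ[k] A} (hε : ∀ a, ε₁ (ε₂ a) = ε₂ (ε₁ a))
    {τ₁ τ₂ : List A → A} {η : k} (hη : η * η = 1)
    (h₁ : ∀ v, τ₁ (v.map ε₂) = η • ε₂ (τ₁ v)) (h₂ : ∀ v, τ₂ (v.map ε₁) = η • ε₁ (τ₂ v))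
    {σ : List A → W} (hσ : IsMultilinear k σ) (w : List A) :
    insertion ε₂ τ₂ (insertion ε₁ τ₁ σ) w - η • insertion ε₁ τ₁ (insertion ε₂ τ₂ σ) w =
      insertion (ε₁ ∘ₗ ε₂)
        (fun v => insertion ε₂ τ₂ τ₁ v - η • insertion ε₁ τ₁ τ₂ v) σ w := by
  -- one of the two orders of insertion, expanded at the first letter
  have key : ∀ {σ : List A → W}, IsMultilinear k σ →
      ∀ {ε₁ ε₂ : A →ₗ[k] A} {τ₁ τ₂ : List A → A} (a : A) (w : List A),
      (∀ v, τ₁ (v.map ε₂) = η • ε₂ (τ₁ v)) →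
      insertion ε₂ τ₂ (insertion ε₁ τ₁ σ) (a :: w) =
        insertion ε₂ τ₂ (insertion ε₁ τ₁ fun x => σ (ε₁ (ε₂ a) :: x)) w +
        splitSum (fun y x => σ (y :: x)) (fun v => insertion ε₂ τ₂ τ₁ (a :: v)) w +
        η • splitSum (fun y x => insertion ε₂ τ₂ (fun z => σ (ε₂ y :: z)) x)
          (fun v => τ₁ (a :: v)) w +
        splitSum (fun y x => insertion ε₁ τ₁ (fun z => σ (ε₁ y :: z)) x)
          (fun v => τ₂ (a :: v)) w := by
    intro σ hσ ε₁ ε₂ τ₁ τ₂ a w h₁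
    have hg : ∀ y y' w, σ ((y + y') :: w) = σ (y :: w) + σ (y' :: w) := hσ.cons_add
    have e1 : ∀ w, splitSum (fun y x => insertion ε₂ τ₂ (fun z => σ (y :: z)) x)
        (fun v => τ₁ (ε₂ a :: v.map ε₂)) w =
        η • splitSum (fun y x => insertion ε₂ τ₂ (fun z => σ (ε₂ y :: z)) x)
          (fun v => τ₁ (a :: v)) w := by
      intro w
      rw [← splitSum_smul_right]
      refine splitSum_congr fun v x _ => ?_
      rw [← List.map_cons, h₁, ← insertion_smul]
      simp only [hσ.cons_smul]
    rw [insertion_cons]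
    simp only [insertion_cons, insertion_add, splitSum_add_right]
    rw [insertion_splitSum _ _ hg, e1, splitSum_splitSum hg (fun y x => τ₁ (y :: x)),
      splitSum_add hg]
    abel
  induction w generalizing σ with
  | nil => simp
  | cons a w ih =>
    rw [key hσ a w h₁, key hσ a w h₂, insertion_cons, LinearMap.comp_apply, ← ih (hσ.cons _),
      hε]
    have hg : ∀ y y' w, σ ((y + y') :: w) = σ (y :: w) + σ (y' :: w) := hσ.cons_add
    have e : ∀ f f' : List A → A, splitSum (fun y x => σ (y :: x)) (fun v => f v - η • f' v) w =
        splitSum (fun y x => σ (y :: x)) f w - η • splitSum (fun y x => σ (y :: x)) f' w := by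
      intro f f'
      simp only [sub_eq_add_neg, ← neg_smul]
      rw [splitSum_add hg, splitSum_smul fun c y w => hσ.cons_smul c y w]
    rw [e]
    simp only [smul_add, smul_smul, hη, one_smul]
    abel

end Insertion

end Calculus

/-! ### The linear and the higher part, and locality in the length of words -/

section Arity

variable {A : Type v} {W : Type w} [AddCommGroup W]

/-- The arity one function with value `φ`. -/
def arityOne (φ : A → W) : List A → W
  | [a] => φ a
  | _ => 0

/-- The part of arity at least two. -/
def higherPart (f : List A → W) : List A → W
  | [] => 0
  | [_] => 0
  | a :: b :: w => f (a :: b :: w)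

@[simp] theorem arityOne_nil (φ : A → W) : arityOne φ [] = 0 := rfl
@[simp] theorem arityOne_singleton (φ : A → W) (a : A) : arityOne φ [a] = φ a := rfl
@[simp] theorem arityOne_cons_cons (φ : A → W) (a b : A) (w : List A) :
    arityOne φ (a :: b :: w) = 0 := rfl
@[simp] theorem higherPart_nil (f : List A → W) : higherPart f [] = 0 := rfl
@[simp] theorem higherPart_singleton (f : List A → W) (a : A) : higherPart f [a] = 0 := rfl
@[simp] theorem higherPart_cons_cons (f : List A → W) (a b : A) (w : List A) :
    higherPart f (a :: b :: w) = f (a :: b :: w) := rfl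

theorem arityOne_add_higherPart {f : List A → W} (h0 : f [] = 0) {φ : A → W}
    (h1 : ∀ a, f [a] = φ a) (w : List A) : arityOne φ w + higherPart f w = f w := by
  match w with
  | [] => simp [h0]
  | [a] => simp [h1]
  | a :: b :: w => simp

theorem splitSum_arityOne_cons (φ : A → W) (τ : List A → A) (w : List A) :
    splitSum (fun y x => arityOne φ (y :: x)) τ w = φ (τ w) := by
  induction w generalizing τ with
  | nil => rfl
  | cons a w ih => simp [splitSum, ih]

end Arity

section Locality

variable {k : Type u} [Field k] {A : Type v} [AddCommGroup A] [Module k A]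
  {W : Type w} [AddCommGroup W] [Module k W]

theorem isMultilinear_arityOne (φ : A →ₗ[k] W) : IsMultilinear k (arityOne φ) := by
  constructor
  · intro u x a b
    match u, x with
    | [], [] => simp
    | [], _ :: _ => simp
    | [_], _ => simp
    | _ :: _ :: _, _ => simp
  · intro u x c a
    match u, x with
    | [], [] => simp
    | [], _ :: _ => simp
    | [_], _ => simp
    | _ :: _ :: _, _ => simp

theorem IsMultilinear.higherPart {f : List A → W} (hf : IsMultilinear k f) :
    IsMultilinear k (higherPart f) := by
  constructor
  · intro u x a b
    match u, x with
    | [], [] => simp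
    | [], _ :: _ => exact hf.map_add [] _ _ _
    | [c], _ => exact hf.map_add [c] _ _ _
    | c :: d :: u, _ => exact hf.map_add (c :: d :: u) _ _ _
  · intro u x c a
    match u, x with
    | [], [] => simp
    | [], _ :: _ => exact hf.map_smul [] _ _ _
    | [c], _ => exact hf.map_smul [c] _ _ _
    | c :: d :: u, _ => exact hf.map_smul (c :: d :: u) _ _ _

variable (ε : A →ₗ[k] A)

theorem insertion_eq_zero {τ : List A → A} {ψ : List A → W} (hψ : ∀ x, x ≠ [] → ψ x = 0)
    (w : List A) : insertion ε τ ψ w = 0 := by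
  induction w generalizing ψ with
  | nil => rfl
  | cons a w ih =>
    rw [insertion_cons, ih fun x _ => hψ _ (List.cons_ne_nil _ _), zero_add]
    have h : (fun (y : A) (x : List A) => ψ (y :: x)) = fun _ _ => (0 : W →ₗ[k] W) 0 := by
      funext y x; exact hψ _ (List.cons_ne_nil _ _)
    rw [h, splitSum_comp (0 : W →ₗ[k] W) (fun _ _ => 0), LinearMap.zero_apply]

/-- Composition with a cochain that is purely linear: `φ ∘ τ`. -/
theorem insertion_arityOne (φ : A →ₗ[k] W) (τ : List A → A) (h0 : τ [] = 0) (w : List A) :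
    insertion ε τ (arityOne φ) w = φ (τ w) := by
  cases w with
  | nil => simp [h0]
  | cons a w =>
    rw [insertion_cons, splitSum_arityOne_cons, insertion_eq_zero, zero_add]
    intro x hx
    cases x with
    | nil => exact absurd rfl hx
    | cons _ _ => rfl

/-- A linear map acts on the letters of a word one at a time. -/
theorem insertion_arityOne_left {φ : A → A} {σ : List A → W} (hσ : IsMultilinear k σ)
    (a : A) (w : List A) : insertion ε (arityOne φ) σ (a :: w) =
      insertion ε (arityOne φ) (fun x => σ (ε a :: x)) w + σ (φ a :: w) := by
  have h0 : ∀ (b : A) (w : List A),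
      splitSum (fun y x => σ (y :: x)) (fun v => arityOne φ (a :: b :: v)) w = 0 :=
    fun b w => splitSum_zero (fun w => hσ.cons_zero w) w
  rw [insertion_cons]
  congr 1
  cases w with
  | nil => rfl
  | cons b w => rw [splitSum, h0]; simp

/-- If `σ` vanishes in arity at most one, then `(σ ∘ τ)(w)` involves `τ` only on words shorter than
`w`. -/
theorem insertion_higherPart_congr_left {W : Type*} [AddCommGroup W] {τ τ' : List A → A}
    {σ : List A → W} {n : ℕ}
    (h : ∀ v, v.length < n → τ v = τ' v) {w : List A} (hw : w.length ≤ n) :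
    insertion ε τ (higherPart σ) w = insertion ε τ' (higherPart σ) w := by
  cases w with
  | nil => rfl
  | cons a w =>
    have hlt : w.length < n := by simpa [Nat.succ_le_iff] using hw
    rw [insertion_cons, insertion_cons]
    congr 1
    · exact insertion_congr_left (n := w.length) ε (fun v hv => h v (by omega)) le_rfl
    · refine splitSum_congr fun v x hx => ?_
      cases x with
      | nil => rfl
      | cons b x =>
        rw [h]
        rw [hx] at hlt
        simp at hlt ⊢
        omega

/-- If `τ` vanishes in arity at most one, then `(σ ∘ τ)(w)` involves `σ` only on words shorter than
`w`. -/
theorem insertion_higherPart_congr_right {τ : List A → A} {σ σ' : List A → W}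
    (hσ : IsMultilinear k σ) (hσ' : IsMultilinear k σ') {n : ℕ}
    (h : ∀ v, v.length < n → σ v = σ' v) {w : List A} (hw : w.length ≤ n) :
    insertion ε (higherPart τ) σ w = insertion ε (higherPart τ) σ' w := by
  induction w generalizing σ σ' n with
  | nil => rfl
  | cons a w ih =>
    have hw' : w.length + 1 ≤ n := by simpa using hw
    rw [insertion_cons, insertion_cons]
    congr 1
    · refine ih (n := n - 1) (hσ.cons _) (hσ'.cons _) (fun v hv => h _ ?_) (by omega)
      simp; omega
    · refine splitSum_congr fun v x hx => ?_
      cases v with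
      | nil => simp [hσ.cons_zero, hσ'.cons_zero]
      | cons b v =>
        refine h _ ?_
        rw [hx] at hw'
        simp at hw' ⊢
        omega

/-- Insertion of a linear map preserves the length of words. -/
theorem insertion_arityOne_congr_right {φ : A → A} {σ σ' : List A → W}
    (hσ : IsMultilinear k σ) (hσ' : IsMultilinear k σ') {w : List A}
    (h : ∀ v, v.length = w.length → σ v = σ' v) :
    insertion ε (arityOne φ) σ w = insertion ε (arityOne φ) σ' w := by
  induction w generalizing σ σ' with
  | nil => rfl
  | cons a w ih =>
    rw [insertion_arityOne_left _ hσ, insertion_arityOne_left _ hσ', h _ (by simp),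
      ih (hσ.cons _) (hσ'.cons _)]
    intro v hv
    exact h _ (by simp [hv])

end Locality

/-! ### Inverting a scalar plus a sum of commuting idempotents -/

section Shift

variable {k : Type u} [Field k] {A : Type v} [AddCommGroup A] [Module k A]
  {W : Type w} [AddCommGroup W] [Module k W]

/-- The inverse of `σ ↦ c • σ + σ ∘ e` for an idempotent `e`, by recursion on the word: splitting
the first letter as `(a - e a) + e a`, the operator becomes the one for `c` on the first summand and
the one for `c + 1` on the second. -/
def shiftInv (e : A →ₗ[k] A) : k → (List A → W) → List A → W
  | c, K, [] => c⁻¹ • K []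
  | c, K, a :: w => shiftInv e c (fun x => K ((a - e a) :: x)) w +
      shiftInv e (c + 1) (fun x => K (e a :: x)) w

variable (e : A →ₗ[k] A)

theorem shiftInv_add (c : k) (K K' : List A → W) (w : List A) :
    shiftInv e c (fun x => K x + K' x) w = shiftInv e c K w + shiftInv e c K' w := by
  induction w generalizing c K K' with
  | nil => simp [shiftInv]
  | cons a w ih => simp only [shiftInv, ih]; abel

theorem shiftInv_smul (c c' : k) (K : List A → W) (w : List A) :
    shiftInv e c (fun x => c' • K x) w = c' • shiftInv e c K w := by
  induction w generalizing c K with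
  | nil => exact smul_comm _ _ _
  | cons a w ih => simp only [shiftInv, ih, smul_add]

theorem IsMultilinear.shiftInv {K : List A → W} (hK : IsMultilinear k K) (c : k) :
    IsMultilinear k (shiftInv e c K) := by
  constructor
  · intro u x a b
    induction u generalizing c K with
    | nil =>
      simp only [List.nil_append, AInfinity.shiftInv, _root_.map_add, hK.cons_add,
        add_sub_add_comm, shiftInv_add]
      abel
    | cons d u ih =>
      simp only [List.cons_append, AInfinity.shiftInv, ih (hK.cons _)]
      abel
  · intro u x c' a
    induction u generalizing c K with
    | nil =>
      simp only [List.nil_append, AInfinity.shiftInv, _root_.map_smul, hK.cons_smul,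
        ← smul_sub, shiftInv_smul, smul_add]
    | cons d u ih =>
      simp only [List.cons_append, AInfinity.shiftInv, ih (hK.cons _), smul_add]

theorem shiftInv_congr {c : k} {K K' : List A → W} {w : List A}
    (h : ∀ v, v.length = w.length → K v = K' v) : shiftInv e c K w = shiftInv e c K' w := by
  induction w generalizing c K K' with
  | nil => simp [shiftInv, h [] rfl]
  | cons a w ih =>
    simp only [shiftInv]
    rw [ih fun v hv => h _ (by simp [hv]), ih fun v hv => h _ (by simp [hv])]

theorem shiftInv_spec (he : ∀ a, e (e a) = e a) {c : k} (hc : ∀ n : ℕ, c + n ≠ 0)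
    {K : List A → W} (hK : IsMultilinear k K) (w : List A) :
    c • shiftInv e c K w +
      insertion (k := k) LinearMap.id (arityOne e) (shiftInv e c K) w = K w := by
  induction w generalizing c K with
  | nil =>
    have h : c ≠ 0 := by simpa using hc 0
    simp [shiftInv, smul_smul, h]
  | cons a w ih =>
    have h1 := ih hc (hK.cons (a - e a))
    have h2 := ih (c := c + 1) (fun n => by
      have := hc (n + 1)
      push_cast at this
      rwa [add_assoc, add_comm 1]) (hK.cons (e a))
    have h0 : shiftInv e c (fun x => K (0 :: x)) w = 0 := by
      simpa [hK.cons_zero] using shiftInv_smul e c 0 (fun x => K (0 :: x)) w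
    rw [insertion_arityOne_left _ (hK.shiftInv e c)]
    simp only [shiftInv, LinearMap.id_apply, he, sub_self, h0, zero_add]
    rw [insertion_add, ← sub_add_cancel a (e a), hK.cons_add, sub_add_cancel, ← h1, ← h2, add_smul,
      one_smul, smul_add]
    abel

/-- Injectivity of `σ ↦ c • σ + σ ∘ e` in arity `n`, where the eigenvalues are `c, …, c + n`. -/
theorem eq_zero_of_shift (he : ∀ a, e (e a) = e a) {c : k} {G : List A → W}
    (hG : IsMultilinear k G) {n : ℕ} (hc : ∀ m ≤ n, c + m ≠ 0)
    (h : ∀ w : List A, w.length = n →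
      c • G w + insertion (k := k) LinearMap.id (arityOne e) G w = 0) :
    ∀ w : List A, w.length = n → G w = 0 := by
  induction n generalizing c G with
  | zero =>
    intro w hw
    obtain rfl := List.length_eq_zero_iff.1 hw
    have := h [] rfl
    simpa [by simpa using hc 0 le_rfl] using this
  | succ n ih =>
    -- on the image of `e` in the first letter, the constant is `c + 1`
    have h1 : ∀ a w, w.length = n → G (e a :: w) = 0 := by
      intro a
      refine ih (hG.cons _) (c := c + 1) (fun m hm => ?_) fun w hw => ?_
      · have := hc (m + 1) (by omega)
        push_cast at this
        rwa [add_assoc, add_comm 1]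
      · have := h (e a :: w) (by simp [hw])
        rw [insertion_arityOne_left _ hG, he] at this
        rw [← this, LinearMap.id_apply, add_smul, one_smul]
        abel
    intro w hw
    cases w with
    | nil => simp at hw
    | cons a w =>
      refine ih (hG.cons a) (c := c) (fun m hm => hc m (by omega)) (fun w hw => ?_) w
        (by simpa using hw)
      have := h (a :: w) (by simp [hw])
      rwa [insertion_arityOne_left _ hG, h1 a w hw, add_zero] at this

end Shift

/-! ### Homogeneous functions, Euler fields and signs -/

section Homogeneous

variable {k : Type u} [Field k] {A : Type v} [AddCommGroup A] [Module k A]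
  {W : Type w} [AddCommGroup W] [Module k W] {X : Type x} [AddCommGroup X] [Module k X]
  {gA : ℤ → Submodule k A} {gW : ℤ → Submodule k W} {gX : ℤ → Submodule k X}

/-- `w` is a word of homogeneous elements, of degrees `p`. -/
abbrev HasDegrees (gA : ℤ → Submodule k A) (p : List ℤ) (w : List A) : Prop :=
  List.Forall₂ (fun i a => a ∈ gA i) p w

/-- `f` has degree `e` in the sense of `Cochain`: words of homogeneous letters of degrees `pᵢ` are
sent to elements of degree `∑ (pᵢ - 1) + e`. -/
def IsHomogeneous (gA : ℤ → Submodule k A) (gW : ℤ → Submodule k W) (e : ℤ)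
    (f : List A → W) : Prop :=
  ∀ (p : List ℤ) (w : List A), HasDegrees gA p w → f w ∈ gW ((p.map (· - 1)).sum + e)

namespace IsHomogeneous

variable {e e' : ℤ} {f f' : List A → W}

theorem cons (hf : IsHomogeneous gA gW e f) {i : ℤ} {a : A} (ha : a ∈ gA i) :
    IsHomogeneous gA gW (e + (i - 1)) fun x => f (a :: x) := by
  intro p w h
  have := hf (i :: p) (a :: w) (.cons ha h)
  rw [List.map_cons, List.sum_cons] at this
  convert this using 2
  ring

theorem degree_eq (hf : IsHomogeneous gA gW e f) (h : e = e') : IsHomogeneous gA gW e' f :=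
  h ▸ hf

theorem add (hf : IsHomogeneous gA gW e f) (hf' : IsHomogeneous gA gW e f') :
    IsHomogeneous gA gW e fun w => f w + f' w :=
  fun p w h => Submodule.add_mem _ (hf p w h) (hf' p w h)

theorem sub (hf : IsHomogeneous gA gW e f) (hf' : IsHomogeneous gA gW e f') :
    IsHomogeneous gA gW e fun w => f w - f' w :=
  fun p w h => Submodule.sub_mem _ (hf p w h) (hf' p w h)

theorem neg (hf : IsHomogeneous gA gW e f) : IsHomogeneous gA gW e fun w => -f w :=
  fun p w h => Submodule.neg_mem _ (hf p w h)

theorem zero : IsHomogeneous gA gW e fun _ => 0 := fun _ _ _ => Submodule.zero_mem _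

theorem comp (hf : IsHomogeneous gA gW e f) {φ : W →ₗ[k] X} {n : ℤ}
    (hφ : ∀ i, ∀ y ∈ gW i, φ y ∈ gX (i + n)) :
    IsHomogeneous gA gX (e + n) fun w => φ (f w) := fun p w h => by
  rw [← add_assoc]; exact hφ _ _ (hf p w h)

theorem comp' (hf : IsHomogeneous gA gW e f) {φ : W →ₗ[k] X}
    (hφ : ∀ i, ∀ y ∈ gW i, φ y ∈ gX i) :
    IsHomogeneous gA gX e fun w => φ (f w) := fun p w h => hφ _ _ (hf p w h)

theorem arityOne {φ : A → W} (hφ : ∀ i, ∀ a ∈ gA i, φ a ∈ gW (i - 1 + e)) :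
    IsHomogeneous gA gW e (arityOne φ) := by
  intro p w h
  match w, h with
  | [], _ => exact Submodule.zero_mem _
  | [a], .cons (a := i) ha .nil => simpa using hφ i a ha
  | _ :: _ :: _, _ => exact Submodule.zero_mem _

theorem higherPart (hf : IsHomogeneous gA gW e f) : IsHomogeneous gA gW e (higherPart f) := by
  intro p w h
  match w with
  | [] => exact Submodule.zero_mem _
  | [a] => exact Submodule.zero_mem _
  | _ :: _ :: _ => exact hf p _ h

theorem splitSum {f : List A → X} {g : X → List A → W} (hf : IsHomogeneous gA gX e f)
    (hg : ∀ j, ∀ y ∈ gX j, IsHomogeneous gA gW (e' + j) (g y)) :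
    IsHomogeneous gA gW (e + e') (splitSum g f) := by
  intro p w h
  induction h generalizing f e with
  | nil =>
    have := hg _ _ (hf [] [] .nil) [] [] .nil
    simpa [AInfinity.splitSum, add_comm] using this
  | @cons i a p w ha h ih =>
    rw [AInfinity.splitSum]
    refine Submodule.add_mem _ ?_ ?_
    · have := hg _ _ (hf [] [] .nil) _ _ (.cons ha h)
      convert this using 2
      simp [add_comm]
    · have := ih (hf.cons ha)
      convert this using 2
      simp only [List.map_cons, List.sum_cons]
      ring

theorem insertion {ε : A →ₗ[k] A} (hε : ∀ i, ∀ a ∈ gA i, ε a ∈ gA i) {τ : List A → A}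
    (hτ : IsHomogeneous gA gA e' τ) (hf : IsHomogeneous gA gW e f) :
    IsHomogeneous gA gW (e + e' - 1) (insertion ε τ f) := by
  intro p w h
  induction h generalizing f e with
  | nil => exact Submodule.zero_mem _
  | @cons i a p w ha h ih =>
    rw [insertion_cons]
    refine Submodule.add_mem _ ?_ ?_
    · have := ih (hf.cons (hε i a ha))
      convert this using 2
      simp only [List.map_cons, List.sum_cons]
      ring
    · have := (hτ.cons ha).splitSum (g := fun y x => f (y :: x)) (gW := gW) (e' := e - 1)
        (fun j y hy => (hf.cons hy).degree_eq (by ring)) p w h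
      convert this using 2
      simp only [List.map_cons, List.sum_cons]
      ring

theorem shiftInv {φ : A →ₗ[k] A} (hφ : ∀ i, ∀ a ∈ gA i, φ a ∈ gA i)
    (hf : IsHomogeneous gA gW e f) (c : k) : IsHomogeneous gA gW e (shiftInv φ c f) := by
  intro p w h
  induction h generalizing c f e with
  | nil => exact Submodule.smul_mem _ _ (hf [] [] .nil)
  | @cons i a p w ha h ih =>
    rw [AInfinity.shiftInv]
    have h1 := ih (hf.cons (Submodule.sub_mem _ ha (hφ i a ha))) c
    have h2 := ih (hf.cons (hφ i a ha)) (c + 1)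
    convert Submodule.add_mem _ h1 h2 using 2
    simp only [List.map_cons, List.sum_cons]
    ring

end IsHomogeneous

/-- Multilinear functions are determined by their values on homogeneous words. -/
theorem IsMultilinear.ext_homogeneous (hg : DirectSum.IsInternal gA) {f f' : List A → W}
    (hf : IsMultilinear k f) (hf' : IsMultilinear k f')
    (h : ∀ p w, HasDegrees gA p w → f w = f' w) (w : List A) : f w = f' w := by
  induction w generalizing f f' with
  | nil => exact h [] [] .nil
  | cons a w ih =>
    have ha : a ∈ ⨆ i, gA i := by rw [hg.submodule_iSup_eq_top]; trivial
    induction ha using Submodule.iSup_induction' with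
    | mem i a ha => exact ih (hf.cons a) (hf'.cons a) fun p w hw => h _ _ (.cons ha hw)
    | zero => rw [hf.cons_zero, hf'.cons_zero]
    | add a b _ _ iha ihb => rw [hf.cons_add, hf'.cons_add, iha, ihb]

theorem euler_mem (hg : DirectSum.IsInternal gA) {i : ℤ} {a : A} (ha : a ∈ gA i) :
    euler hg a ∈ gA i := by
  rw [euler_of_mem hg ha]; exact Submodule.smul_mem _ _ ha

theorem insertion_euler (hg : DirectSum.IsInternal gA) {f : List A → W} (hf : IsMultilinear k f)
    {p : List ℤ} {w : List A} (h : HasDegrees gA p w) :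
    insertion (k := k) LinearMap.id (arityOne (euler hg)) f w = (p.sum : k) • f w := by
  induction h generalizing f with
  | nil => simp
  | @cons i a p w ha h ih =>
    rw [insertion_arityOne_left _ hf, euler_of_mem hg ha, hf.cons_smul, LinearMap.id_apply,
      ih (hf.cons a), ← add_smul, List.sum_cons, Int.cast_add, add_comm]

theorem sum_map_sub_one (p : List ℤ) : (p.map (· - 1)).sum = p.sum - p.length := by
  induction p with
  | nil => simp
  | cons i p ih => simp [ih]; ring

/-- The commutator of the Euler vector fields with the arity `n` part of a cochain of degree `e` is
multiplication by `e - n`. -/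
theorem euler_apply_of_isHomogeneous (hg : DirectSum.IsInternal gA) (hgW : DirectSum.IsInternal gW)
    {f : List A → W} (hf : IsMultilinear k f) {e : ℤ} (h : IsHomogeneous gA gW e f) (w : List A) :
    euler hgW (f w) = ((e : k) - w.length) • f w +
      insertion (k := k) LinearMap.id (arityOne (euler hg)) f w := by
  refine (hf.comp (euler hgW)).ext_homogeneous hg
    ((hf.smul_length fun n => (e : k) - n).add ((isMultilinear_arityOne _).insertion _ hf)) ?_ w
  intro p w hw
  rw [euler_of_mem hgW (h p w hw), insertion_euler hg hf hw, ← add_smul, sum_map_sub_one,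
    hw.length_eq]
  congr 1
  push_cast
  ring

/-- The sign `(-1)^{|a| - 1}` as an operator. -/
noncomputable def signOp (hg : DirectSum.IsInternal gA) : A →ₗ[k] A :=
  diagonal hg fun i => (-1) ^ (i - 1)

theorem signOp_of_mem (hg : DirectSum.IsInternal gA) {i : ℤ} {a : A} (ha : a ∈ gA i) :
    signOp hg a = ((-1 : k) ^ (i - 1)) • a := diagonal_of_mem hg _ ha

theorem signOp_mem (hg : DirectSum.IsInternal gA) {i : ℤ} {a : A} (ha : a ∈ gA i) :
    signOp hg a ∈ gA i := by
  rw [signOp_of_mem hg ha]; exact Submodule.smul_mem _ _ ha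

theorem neg_one_zpow_mul_self (n : ℤ) : ((-1 : k) ^ n) * (-1) ^ n = 1 := by
  rw [← mul_zpow]; simp

theorem signOp_signOp (hg : DirectSum.IsInternal gA) : signOp hg ∘ₗ signOp hg = LinearMap.id :=
  linearMap_ext hg fun i a ha => by
    rw [LinearMap.comp_apply, signOp_of_mem hg ha, map_smul, signOp_of_mem hg ha, smul_smul,
      neg_one_zpow_mul_self, one_smul, LinearMap.id_apply]

theorem IsMultilinear.map_signOp (hg : DirectSum.IsInternal gA) {f : List A → W}
    (hf : IsMultilinear k f) {p : List ℤ} {w : List A} (h : HasDegrees gA p w) :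
    f (w.map (signOp hg)) = ((-1 : k) ^ (p.map (· - 1)).sum) • f w := by
  induction h generalizing f with
  | nil => simp
  | @cons i a p w ha h ih =>
    rw [List.map_cons, signOp_of_mem hg ha, hf.cons_smul, ih (hf.cons a), List.map_cons,
      List.sum_cons, zpow_add₀ (by simp), smul_smul]

/-- A cochain of degree `e` commutes with the sign operator up to `(-1)^{e - 1}`. -/
theorem IsHomogeneous.map_signOp (hg : DirectSum.IsInternal gA) {τ : List A → A}
    (hτ : IsMultilinear k τ) {e : ℤ} (h : IsHomogeneous gA gA e τ) (w : List A) :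
    τ (w.map (signOp hg)) = ((-1 : k) ^ (e - 1)) • signOp hg (τ w) := by
  refine (hτ.comp_map _).ext_homogeneous hg
    (hτ.comp ((((-1 : k) ^ (e - 1)) • signOp hg))) ?_ w
  intro p w hw
  rw [hτ.map_signOp hg hw, LinearMap.smul_apply, signOp_of_mem hg (h p w hw), smul_smul,
    add_sub_assoc, zpow_add₀ (by simp), mul_left_comm, neg_one_zpow_mul_self, mul_one]

/-- Linear maps can be defined degreewise. -/
theorem exists_linearMap_of_graded (hg : DirectSum.IsInternal gA) (φ : ℤ → A →ₗ[k] W) :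
    ∃ ψ : A →ₗ[k] W, ∀ i, ∀ a ∈ gA i, ψ a = φ i a := by
  refine ⟨(DirectSum.toModule k ℤ W fun i => φ i ∘ₗ (gA i).subtype) ∘ₗ
    (LinearEquiv.ofBijective (DirectSum.coeLinearMap gA) (bijective_coe hg)).symm.toLinearMap,
    fun i a ha => ?_⟩
  have h : (LinearEquiv.ofBijective (DirectSum.coeLinearMap gA) (bijective_coe hg)).symm a =
      DirectSum.lof k ℤ (fun i => gA i) i ⟨a, ha⟩ := by
    rw [LinearEquiv.symm_apply_eq]
    simp
  simp only [LinearMap.comp_apply, LinearEquiv.coe_coe, h, DirectSum.toModule_lof]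
  simp

/-- A graded linear map has a graded generalized inverse. -/
theorem exists_graded_generalizedInverse (hgA : DirectSum.IsInternal gA)
    (hgW : DirectSum.IsInternal gW) (f : A →ₗ[k] W) (n : ℤ)
    (hf : ∀ i, ∀ a ∈ gA i, f a ∈ gW (i + n)) :
    ∃ g : W →ₗ[k] A, (∀ j, ∀ y ∈ gW j, g y ∈ gA (j - n)) ∧ ∀ a, f (g (f a)) = f a := by
  have h : ∀ i, ∃ g : W →ₗ[k] gA i, ∀ a : gA i, f (g (f a)) = f a := by
    intro i
    set fi := f ∘ₗ (gA i).subtype with hfi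
    obtain ⟨r, hr⟩ := fi.rangeRestrict.exists_rightInverse_of_surjective fi.range_rangeRestrict
    obtain ⟨g, hg⟩ := LinearMap.exists_extend r
    refine ⟨g, fun a => ?_⟩
    have h1 : g (f a) = r (fi.rangeRestrict a) := LinearMap.congr_fun hg (fi.rangeRestrict a)
    rw [h1]
    exact congrArg Subtype.val (LinearMap.congr_fun hr (fi.rangeRestrict a))
  choose g hg using h
  obtain ⟨ψ, hψ⟩ := exists_linearMap_of_graded hgW fun j => (gA (j - n)).subtype ∘ₗ g (j - n)
  refine ⟨ψ, fun j y hy => ?_, fun a => ?_⟩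
  · rw [hψ j y hy]; exact SetLike.coe_mem _
  · have : f ∘ₗ ψ ∘ₗ f = f := linearMap_ext hgA fun i a ha => by
      have h1 := hψ _ _ (hf i a ha)
      simp only [LinearMap.comp_apply] at h1 ⊢
      rw [h1, Submodule.coe_subtype]
      have h2 : ∀ j (hj : j = i), f ((g j (f a) : gA j) : A) = f a := by
        rintro _ rfl
        exact hg _ ⟨a, ha⟩
      exact h2 _ (add_sub_cancel_right i n)
    exact LinearMap.congr_fun this a

end Homogeneous

/-! ### Cochains as functions of words -/

section Words

/-- The list `[a 0, …, a (n - 1)]`. -/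
def word {A : Type v} (a : ℕ → A) : ℕ → List A
  | 0 => []
  | n + 1 => a 0 :: word (fun t => a (t + 1)) n

@[simp] theorem length_word {A : Type v} (a : ℕ → A) (n : ℕ) : (word a n).length = n := by
  induction n generalizing a with
  | zero => rfl
  | succ n ih => simp [word, ih]

theorem getElem_word {A : Type v} (a : ℕ → A) (n i : ℕ) (h : i < (word a n).length) :
    (word a n)[i] = a i := by
  induction n generalizing a i with
  | zero => simp [word] at h
  | succ n ih => cases i with
    | zero => rfl
    | succ i => simp [word, ih]

theorem splitSum_word {L : Type v} {W : Type w} [AddCommGroup W] {X : Type x}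
    (g : X → List L → W) (f : List L → X) (a : ℕ → L) (d : ℕ) :
    splitSum g f (word a d) =
      ∑ j ∈ range (d + 1), g (f (word a j)) (word (fun t => a (t + j)) (d - j)) := by
  induction d generalizing a f with
  | zero => simp [word, splitSum]
  | succ d ih =>
    rw [Finset.sum_range_succ', show word a (d + 1) = a 0 :: word (fun t => a (t + 1)) d from rfl,
      splitSum, ih, add_comm]
    congr 1
    refine Finset.sum_congr rfl fun j _ => ?_
    rw [Nat.add_sub_add_right]
    simp only [word, add_assoc]

theorem ofFn_update_eq {A : Type v} {n : ℕ} [DecidableEq (Fin n)] (m : Fin n → A) (i : Fin n) :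
    ∃ u x : List A, ∀ a, List.ofFn (Function.update m i a) = u ++ a :: x := by
  refine ⟨(List.ofFn m).take i, (List.ofFn m).drop (i + 1), fun a => ?_⟩
  have h : List.ofFn (Function.update m i a) = (List.ofFn m).set i a := by
    refine List.ext_getElem (by simp) fun j h h' => ?_
    rw [List.getElem_ofFn, List.getElem_set, List.getElem_ofFn, Function.update_apply]
    simp only [Fin.ext_iff, eq_comm]
  rw [h, List.set_eq_take_append_cons_drop, if_pos (by simp)]

end Words

section Cochains

variable {k : Type u} [Field k] {A : Type v} [AddCommGroup A] [Module k A]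
  {W : Type w} [AddCommGroup W] [Module k W]
  {gA : ℤ → Submodule k A} {gW : ℤ → Submodule k W} {e e' : ℤ}

/-- A homogeneous word is an initial segment of a sequence of homogeneous elements; the sequence is
continued by zero, which lies in every degree. -/
theorem exists_word_of_hasDegrees {p : List ℤ} {w : List A} (h : HasDegrees gA p w) :
    ∃ (p' : ℕ → ℤ) (a : ℕ → A), (∀ t, a t ∈ gA (p' t)) ∧ word a w.length = w := by
  refine ⟨fun i => p.getD i 0, fun i => w.getD i 0, fun t => ?_,
    List.ext_getElem (by simp) fun i h h' => by rw [getElem_word, List.getD_eq_getElem]⟩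
  have hl := h.length_eq
  by_cases ht : t < w.length
  · dsimp only
    rw [List.getD_eq_getElem _ _ ht, List.getD_eq_getElem _ _ (hl ▸ ht)]
    exact h.get (hl ▸ ht) ht
  · dsimp only
    rw [List.getD_eq_default _ _ (not_lt.1 ht)]
    exact Submodule.zero_mem _

namespace Cochain

/-- A cochain as a function of words, of arbitrary length. -/
def toFun (σ : Cochain gA gW e) (w : List A) : W := σ.map w.length w.get

theorem toFun_eq (σ : Cochain gA gW e) {w : List A} {n : ℕ} (h : w.length = n) :
    σ.toFun w = σ.map n fun i => w.get (i.cast h.symm) := by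
  subst h; rfl

theorem toFun_word (σ : Cochain gA gW e) (a : ℕ → A) (n : ℕ) :
    σ.toFun (word a n) = σ.map n fun t => a t := by
  rw [σ.toFun_eq (length_word a n)]
  congr 1
  funext t
  simp [getElem_word]

theorem toFun_singleton (σ : Cochain gA gW e) (a : A) : σ.toFun [a] = σ.linear a := by
  simp only [Cochain.linear, MultilinearMap.ofSubsingleton_symm_apply_apply]
  refine congrArg (σ.map 1) (funext fun i : Fin 1 => ?_)
  rw [Subsingleton.elim i 0]
  rfl

theorem toFun_nil (σ : Cochain gA gW e) (h : σ.map 0 = 0) : σ.toFun [] = 0 := by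
  rw [σ.toFun_eq (n := 0) rfl, h, _root_.zero_apply]

theorem isMultilinear_toFun (σ : Cochain gA gW e) : IsMultilinear k σ.toFun := by
  have key : ∀ u x : List A, ∃ (n : ℕ) (m : Fin n → A) (i : Fin n),
      ∀ a, σ.toFun (u ++ a :: x) = σ.map n (Function.update m i a) := by
    intro u x
    have hl : ∀ a, (u ++ a :: x).length = u.length + (x.length + 1) := by simp
    refine ⟨u.length + (x.length + 1), fun i => (u ++ 0 :: x).get (i.cast (hl 0).symm),
      ⟨u.length, by omega⟩, fun a => ?_⟩
    rw [σ.toFun_eq (hl a)]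
    congr 1
    funext j
    by_cases hj : j.1 = u.length
    · simp [Function.update_apply, Fin.ext_iff, hj, List.getElem_append]
    · simp only [Function.update_apply, Fin.ext_iff, hj, if_false, List.get_eq_getElem,
        Fin.val_cast, List.getElem_append, List.getElem_cons]
      split_ifs
      · rfl
      · omega
      · rfl
  constructor
  · intro u x a b
    obtain ⟨n, m, i, h⟩ := key u x
    rw [h, h, h, MultilinearMap.map_update_add]
  · intro u x c a
    obtain ⟨n, m, i, h⟩ := key u x
    rw [h, h, MultilinearMap.map_update_smul]

theorem isHomogeneous_toFun (σ : Cochain gA gW e) : IsHomogeneous gA gW e σ.toFun := by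
  intro p w h
  have hl := h.length_eq
  have := σ.map_mem w.length (fun i => p.get (i.cast hl.symm)) w.get fun i => h.get _ _
  have hs : (p.map (· - 1)).sum = ∑ i : Fin w.length, (p.get (i.cast hl.symm) - 1) := by
    rw [← List.sum_ofFn]
    congr 1
    refine List.ext_getElem (by simp [hl]) fun i h h' => ?_
    simp
  rw [hs]
  exact this

/-- The cochain with given values on words. -/
def ofFun (f : List A → W) (hf : IsMultilinear k f) (h : IsHomogeneous gA gW e f) :
    Cochain gA gW e where
  map s :=
    { toFun := fun m => f (List.ofFn m)
      map_update_add' := fun m i a b => by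
        obtain ⟨u, x, h⟩ := ofFn_update_eq m i
        rw [h, h, h, hf.map_add]
      map_update_smul' := fun m i c a => by
        obtain ⟨u, x, h⟩ := ofFn_update_eq m i
        rw [h, h, hf.map_smul] }
  map_mem s p a ha := by
    have := h (List.ofFn p) (List.ofFn a) (List.forall₂_iff_get.2
      ⟨by simp, fun i h h' => by simpa using ha _⟩)
    simpa [List.sum_ofFn] using this

theorem toFun_ofFun (f : List A → W) (hf : IsMultilinear k f) (h : IsHomogeneous gA gW e f)
    (w : List A) : (ofFun f hf h).toFun w = f w := by
  change f (List.ofFn w.get) = f w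
  rw [List.ofFn_get]

theorem ofFun_zero {f : List A → W} (hf : IsMultilinear k f) (h : IsHomogeneous gA gW e f)
    (h0 : f [] = 0) : (ofFun f hf h).map 0 = 0 := by
  ext m
  change f (List.ofFn m) = 0
  rwa [List.ofFn_zero]

end Cochain

/-- The sum defining the convolution is an insertion. The summands with `j = 0` do not contribute,
as `τ⁰ = 0`. -/
theorem insertion_word {ε : A →ₗ[k] A} {n : ℤ} {p : ℕ → ℤ} {a : ℕ → A}
    (hε : ∀ t, ε (a t) = ((-1 : k) ^ (n * (p t - 1))) • a t) {τ : List A → A} (h0 : τ [] = 0)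
    {f : List A → W} (hf : IsMultilinear k f) (d : ℕ) :
    ∑ j ∈ range (d + 1), ∑ i ∈ range (d - j + 1), ((-1 : k) ^ (n * dagger p i)) •
      f (word (replaceBlock a i j (τ (word (fun u => a (i + u)) j))) (d - j + 1)) =
    insertion ε τ f (word a d) := by
  induction d generalizing p a f with
  | zero => simp [word, replaceBlock, h0, hf.cons_zero]
  | succ d ih =>
    simp only [Finset.sum_range_succ' _ (d + 1 - _)]
    rw [Finset.sum_add_distrib, word, insertion_cons]
    congr 1
    · rw [Finset.sum_range_succ, Nat.sub_self, Finset.sum_range_zero, add_zero,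
        ← ih (p := fun t => p (t + 1)) (fun t => hε (t + 1)) (hf.cons _)]
      refine Finset.sum_congr rfl fun j hj => ?_
      have hj' : d + 1 - j = d - j + 1 := by have := Finset.mem_range.1 hj; omega
      rw [hj']
      refine Finset.sum_congr rfl fun i _ => ?_
      have h1 : ∀ y, word (replaceBlock a (i + 1) j y) (d - j + 1 + 1) =
          a 0 :: word (replaceBlock (fun t => a (t + 1)) i j y) (d - j + 1) := by
        intro y
        rw [word]
        congr 2
        · funext t
          simp only [replaceBlock, Nat.add_lt_add_iff_right, Nat.add_right_cancel_iff]
          split_ifs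
          · rfl
          · rfl
          · congr 1; omega
      have h2 : dagger p (i + 1) = (p 0 - 1) + dagger (fun t => p (t + 1)) i := by
        rw [dagger, Finset.sum_range_succ', add_comm]; rfl
      rw [h1, hε, hf.cons_smul, smul_smul, h2, mul_add, zpow_add₀ (by simp), mul_comm]
      simp only [add_right_comm]
    · rw [splitSum_word, Finset.sum_range_succ']
      have h3 : ∀ (j : ℕ) (y : A) (n : ℕ), word (replaceBlock a 0 j y) (n + 1) =
          y :: word (fun t => a (t + j)) n := by
        intro j y n
        rw [word]
        congr 2
        funext t
        simp only [replaceBlock]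
        rw [if_neg (by omega), if_neg (by omega)]
        congr 1; omega
      rw [h3, word, h0, hf.cons_zero, smul_zero, add_zero]
      refine Finset.sum_congr rfl fun j _ => ?_
      rw [h3, Nat.add_sub_add_right]
      simp [word, dagger, add_assoc]

theorem convolution_eq_insertion (σ : Cochain gA gW e) (τ : Cochain gA gA e') (h0 : τ.map 0 = 0)
    {ε : A →ₗ[k] A} (hε : ∀ i, ∀ a ∈ gA i, ε a = ((-1 : k) ^ ((e' - 1) * (i - 1))) • a)
    {p : ℕ → ℤ} {a : ℕ → A} (ha : ∀ t, a t ∈ gA (p t)) (d : ℕ) :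
    convolution σ τ p a d = insertion ε τ.toFun σ.toFun (word a d) := by
  rw [← insertion_word (fun t => hε _ _ (ha t)) (τ.toFun_nil h0) σ.isMultilinear_toFun]
  simp only [Cochain.toFun_word]
  rfl

/-- If the only operation on the target is a product, the left hand side of the equation for
`A∞`-homomorphisms is a sum over the ways of cutting the word into two. -/
theorem sum_composition_eq_splitSum (F : Cochain gA gW e) (h0 : F.map 0 = 0)
    (M : (r : ℕ) → MultilinearMap k (fun _ : Fin r => W) W) (hM : ∀ r, r ≠ 2 → M r = 0)
    (m : W →ₗ[k] W →ₗ[k] W) (hm : ∀ y : Fin 2 → W, M 2 y = m (y 1) (y 0)) (a : ℕ → A) (d : ℕ) :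
    ∑ c : Composition d, M c.length
        (fun i => F.map (c.blocksFun i) fun u => a (c.embedding i u)) =
      splitSum (fun y x => m (F.toFun x) y) F.toFun (word a d) := by
  classical
  have hM' : ∀ (r : ℕ) (hr : r = 2) (y : Fin r → W),
      M r y = m (y ⟨1, by omega⟩) (y ⟨0, by omega⟩) := by
    rintro _ rfl y; exact hm y
  rw [splitSum_word, ← Finset.sum_filter_add_sum_filter_not Finset.univ
    (fun c : Composition d => c.length = 2), Finset.sum_eq_zero (s := Finset.univ.filter
    fun c : Composition d => ¬ c.length = 2), add_zero]
  · have hb : ∀ c : Composition d, c.length = 2 →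
        c.blocks = [c.sizeUpTo 1, d - c.sizeUpTo 1] ∧ c.sizeUpTo 1 ≤ d := by
      intro c hc
      obtain ⟨x, y, hxy⟩ := List.length_eq_two.1 hc
      have h1 : c.sizeUpTo 1 = x := by simp [Composition.sizeUpTo, hxy]
      have h2 : x + y = d := by simpa [hxy] using c.blocks_sum
      rw [h1, hxy, ← h2]
      simp
    refine Finset.sum_of_injOn (fun c => c.sizeUpTo 1) ?_ ?_ ?_ ?_
    · intro c hc c' hc' h
      have h1 := hb c (by simpa using hc)
      have h2 := hb c' (by simpa using hc')
      refine Composition.ext ?_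
      dsimp only at h
      rw [h1.1, h2.1, h]
    · intro c hc
      have h1 := hb c (by simpa using hc)
      simpa [Nat.lt_succ_iff] using h1.2
    · intro j hj hj'
      rcases Nat.eq_zero_or_pos j with rfl | hj0
      · rw [word, F.toFun_nil h0, map_zero]
      · rcases Nat.lt_or_ge j d with hjd | hjd
        · refine absurd ⟨⟨[j, d - j], ?_, ?_⟩, ?_, ?_⟩ hj'
          · intro i hmem
            simp only [List.mem_cons, List.not_mem_nil, or_false] at hmem
            omega
          · simp; omega
          · simp [Composition.length]
          · simp [Composition.sizeUpTo]
        · have : d - j = 0 := by omega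
          rw [this, word, F.toFun_nil h0, map_zero, LinearMap.zero_apply]
    · intro c hc
      have hc2 : c.length = 2 := by simpa using hc
      have h1 := hb c hc2
      rw [hM' _ hc2]
      have hF : ∀ (i : Fin c.length) (s n : ℕ), c.sizeUpTo i = s → c.blocksFun i = n →
          (F.map (c.blocksFun i) fun u => a (c.embedding i u)) =
            F.toFun (word (fun t => a (t + s)) n) := by
        rintro i _ _ rfl rfl
        rw [F.toFun_word]
        simp only [Composition.coe_embedding, add_comm]
      rw [hF ⟨1, by omega⟩ (c.sizeUpTo 1) (d - c.sizeUpTo 1) rfl,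
        hF ⟨0, by omega⟩ 0 (c.sizeUpTo 1) (c.sizeUpTo_zero)]
      · rfl
      · exact List.getElem_of_eq h1.1 _
      · exact List.getElem_of_eq h1.1 _
  · intro c hc
    rw [hM _ (by simpa using hc), _root_.zero_apply]

end Cochains

/-! ### Recursion on the length of words -/

section FixedPoint

variable {k : Type u} [Field k] {A : Type v} [AddCommGroup A] [Module k A]
  {W : Type w} [AddCommGroup W] [Module k W]
  {gA : ℤ → Submodule k A} {gW : ℤ → Submodule k W} {e : ℤ}

theorem IsMultilinear.of_length {g : ℕ → List A → W} (hg : ∀ n, IsMultilinear k (g n)) :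
    IsMultilinear k fun w => g w.length w := by
  refine ⟨fun u x a b => ?_, fun u x c a => ?_⟩
  · simp only [List.length_append, List.length_cons]
    exact (hg _).map_add _ _ _ _
  · simp only [List.length_append, List.length_cons]
    exact (hg _).map_smul _ _ _ _

/-- Recursion on the length of words: an operator on cochains whose output on words of length `n`
depends only on the input on words of length less than `n` has a fixed point. -/
theorem exists_fixedPoint (Φ : (List A → W) → List A → W)
    (hm : ∀ f, IsMultilinear k f → IsMultilinear k (Φ f))
    (hh : ∀ f, IsHomogeneous gA gW e f → IsHomogeneous gA gW e (Φ f))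
    (hloc : ∀ f f' n, IsMultilinear k f → IsMultilinear k f' →
      (∀ v, v.length < n → f v = f' v) → ∀ w, w.length ≤ n → Φ f w = Φ f' w) :
    ∃ f, IsMultilinear k f ∧ IsHomogeneous gA gW e f ∧ ∀ w, Φ f w = f w := by
  set g : ℕ → List A → W := fun n => Φ^[n] fun _ => 0 with hg
  have hs : ∀ n, g (n + 1) = Φ (g n) := fun n => Function.iterate_succ_apply' _ _ _
  have gm : ∀ n, IsMultilinear k (g n) := by
    intro n
    induction n with
    | zero => exact .zero
    | succ n ih => rw [hs]; exact hm _ ih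
  have gh : ∀ n, IsHomogeneous gA gW e (g n) := by
    intro n
    induction n with
    | zero => exact .zero
    | succ n ih => rw [hs]; exact hh _ ih
  have stab : ∀ n v, v.length < n → g n v = g (n + 1) v := by
    intro n
    induction n with
    | zero => intro v hv; omega
    | succ n ih =>
      intro v hv
      rw [hs n, hs (n + 1)]
      exact hloc _ _ n (gm _) (gm _) ih v (by omega)
  have stab' : ∀ n v, v.length < n → g (v.length + 1) v = g n v := by
    intro n v hv
    induction n, hv using Nat.le_induction with
    | base => rfl
    | succ n hn ih => rw [ih, stab n v hn]
  have fm : IsMultilinear k fun w => g (w.length + 1) w :=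
    .of_length (g := fun n => g (n + 1)) fun n => gm _
  refine ⟨fun w => g (w.length + 1) w, fm, fun p w h => gh _ p w h, fun w => ?_⟩
  rw [hloc _ (g w.length) w.length fm (gm _) (fun v hv => stab' _ v hv) w le_rfl]
  exact congrFun (hs _).symm w

end FixedPoint

/-! ### The structure of an `A∞`-algebra on functions of words -/

namespace AInfAlgebra

variable {k : Type u} [Field k] {A : Type v} [AddCommGroup A] [Module k A]
  {B : Type w} [AddCommGroup B] [Module k B] (𝓐 : AInfAlgebra k A)

/-- The operations of `𝓐`, as a function of words. -/
def ops : List A → A := 𝓐.μ.toFun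

/-- The sign operator of `𝓐`. -/
noncomputable def sgn : A →ₗ[k] A := signOp 𝓐.gr_internal

theorem sgn_of_mem {i : ℤ} {a : A} (ha : a ∈ 𝓐.gr i) :
    𝓐.sgn a = ((-1 : k) ^ (i - 1)) • a := signOp_of_mem _ ha

theorem isMultilinear_ops : IsMultilinear k 𝓐.ops := 𝓐.μ.isMultilinear_toFun

theorem isHomogeneous_ops : IsHomogeneous 𝓐.gr 𝓐.gr 2 𝓐.ops := 𝓐.μ.isHomogeneous_toFun

theorem ops_nil : 𝓐.ops [] = 0 := 𝓐.μ.toFun_nil 𝓐.μ_zero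

theorem ops_singleton (a : A) : 𝓐.ops [a] = 𝓐.d a := 𝓐.μ.toFun_singleton a

theorem ops_pair (a b : A) : 𝓐.ops [a, b] = 𝓐.mul b a := by
  rw [mul_apply, ops, 𝓐.μ.toFun_eq (n := 2) rfl]
  congr 1
  funext i
  fin_cases i <;> rfl

theorem ops_eq_arityOne_add_higherPart (w : List A) :
    𝓐.ops w = arityOne 𝓐.d w + higherPart 𝓐.ops w :=
  (arityOne_add_higherPart 𝓐.ops_nil 𝓐.ops_singleton w).symm

/-- The convolution with `μ` is an insertion. -/
theorem convolution_ops {gB : ℤ → Submodule k B} {e : ℤ} (σ : Cochain 𝓐.gr gB e) {p : ℕ → ℤ}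
    {a : ℕ → A} (ha : ∀ t, a t ∈ 𝓐.gr (p t)) (n : ℕ) :
    convolution σ 𝓐.μ p a n = insertion 𝓐.sgn 𝓐.ops σ.toFun (word a n) :=
  convolution_eq_insertion σ 𝓐.μ 𝓐.μ_zero
    (fun i a ha => by rw [𝓐.sgn_of_mem ha, show ((2 : ℤ) - 1) * (i - 1) = i - 1 by ring]) ha n

/-- For a cochain of degree one, convolution is an insertion without signs. -/
theorem convolution_degree_one {gB : ℤ → Submodule k B} {e : ℤ} (σ : Cochain 𝓐.gr gB e)
    (τ : Cochain 𝓐.gr 𝓐.gr 1) (h0 : τ.map 0 = 0) {p : ℕ → ℤ}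
    {a : ℕ → A} (ha : ∀ t, a t ∈ 𝓐.gr (p t)) (n : ℕ) :
    convolution σ τ p a n =
      insertion (k := k) LinearMap.id τ.toFun σ.toFun (word a n) :=
  convolution_eq_insertion σ τ h0 (fun i a _ => by simp) ha n

theorem insertion_ops_ops (w : List A) : insertion 𝓐.sgn 𝓐.ops 𝓐.ops w = 0 := by
  refine (𝓐.isMultilinear_ops.insertion _ 𝓐.isMultilinear_ops).ext_homogeneous 𝓐.gr_internal
    .zero ?_ w
  intro p w h
  obtain ⟨p', a, ha, hw⟩ := exists_word_of_hasDegrees h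
  have := 𝓐.relation p' a ha w.length
  rwa [𝓐.convolution_ops _ ha, hw] at this

theorem ops_map_sgn (w : List A) : 𝓐.ops (w.map 𝓐.sgn) = (-1 : k) • 𝓐.sgn (𝓐.ops w) := by
  have := 𝓐.isHomogeneous_ops.map_signOp 𝓐.gr_internal 𝓐.isMultilinear_ops w
  rwa [show (2 : ℤ) - 1 = 1 by norm_num, zpow_one] at this

theorem map_sgn_of_degree_one {τ : List A → A} (hm : IsMultilinear k τ)
    (hh : IsHomogeneous 𝓐.gr 𝓐.gr 1 τ) (w : List A) : τ (w.map 𝓐.sgn) = 𝓐.sgn (τ w) := by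
  have := hh.map_signOp 𝓐.gr_internal hm w
  rwa [sub_self, zpow_zero, one_smul] at this

/-- The commutator of `μ` with a derivation of even degree is a derivation. -/
theorem insertion_comm {b : List A → A} (hm : IsMultilinear k b)
    (hh : IsHomogeneous 𝓐.gr 𝓐.gr 1 b) {σ : List A → B} (hσ : IsMultilinear k σ) (w : List A) :
    insertion (k := k) LinearMap.id b (insertion 𝓐.sgn 𝓐.ops σ) w -
        insertion 𝓐.sgn 𝓐.ops (insertion (k := k) LinearMap.id b σ) w =
      insertion 𝓐.sgn (fun v => insertion (k := k) LinearMap.id b 𝓐.ops v -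
        insertion 𝓐.sgn 𝓐.ops b v) σ w := by
  have := insertion_insertion (ε₁ := 𝓐.sgn) (ε₂ := LinearMap.id) (τ₁ := 𝓐.ops) (τ₂ := b)
    (η := (1 : k)) (fun _ => rfl) (one_mul 1) (fun v => by simp)
    (fun v => by rw [one_smul]; exact 𝓐.map_sgn_of_degree_one hm hh v) hσ w
  simpa only [one_smul, LinearMap.comp_id] using this

/-- A cochain of degree one without constant term is an **nc**-vector field if and only if the
derivation of insertion commutes with `μ`. -/
theorem isCocycle_iff (σ : Cochain 𝓐.gr 𝓐.gr 1) (h0 : σ.map 0 = 0) :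
    𝓐.IsCocycle σ ↔ ∀ w, insertion (k := k) LinearMap.id σ.toFun 𝓐.ops w =
      insertion 𝓐.sgn 𝓐.ops σ.toFun w := by
  have key : ∀ {p : ℕ → ℤ} {a : ℕ → A} (_ : ∀ t, a t ∈ 𝓐.gr (p t)) (n : ℕ),
      𝓐.hochschildDifferential σ p a n = 0 ↔
        insertion (k := k) LinearMap.id σ.toFun 𝓐.ops (word a n) =
          insertion 𝓐.sgn 𝓐.ops σ.toFun (word a n) := by
    intro p a ha n
    rw [hochschildDifferential, 𝓐.convolution_ops σ ha, 𝓐.convolution_degree_one _ σ h0 ha,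
      zpow_one, neg_smul, one_smul, add_neg_eq_zero]
    rfl
  constructor
  · intro h
    refine (σ.isMultilinear_toFun.insertion _ 𝓐.isMultilinear_ops).ext_homogeneous 𝓐.gr_internal
      (𝓐.isMultilinear_ops.insertion _ σ.isMultilinear_toFun) ?_
    intro p w hw
    obtain ⟨p', a, ha, hw⟩ := exists_word_of_hasDegrees hw
    have := (key ha w.length).1 (h p' a ha w.length)
    rwa [hw] at this
  · exact fun h p a ha n => (key ha n).2 (h _)

/-- The product in `H(𝓐)` of a cohomology valued function with itself: the sum over all ways of
cutting a word into two of the product of the values on the pieces. -/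
def square (F : List A → 𝓐.Cohomology) : List A → 𝓐.Cohomology :=
  splitSum (fun y x => 𝓐.cohomologyMul (F x) y) F

/-- For maps to `H(𝓐)`, the left hand side of the equation for `A∞`-homomorphisms is `F · F`. -/
theorem sum_composition_cohomology (F : Cochain 𝓐.gr 𝓐.cohomologyGr 1) (h0 : F.map 0 = 0)
    (a : ℕ → A) (n : ℕ) :
    ∑ c : Composition n, 𝓐.cohomologyAlgebra.μ.map c.length
        (fun i => F.map (c.blocksFun i) fun u => a (c.embedding i u)) =
      𝓐.square F.toFun (word a n) :=
  sum_composition_eq_splitSum F h0 _ (fun _ hr => 𝓐.cohomologyOps_ne hr) 𝓐.cohomologyMul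
    (fun _ => rfl) a n

theorem cohomologyAlgebra_d (x : 𝓐.Cohomology) : 𝓐.cohomologyAlgebra.d x = 0 := by
  have h : 𝓐.cohomologyAlgebra.μ.map 1 = 0 := 𝓐.cohomologyOps_ne (by norm_num)
  change (MultilinearMap.ofSubsingleton k _ _ (0 : Fin 1)).symm
    (𝓐.cohomologyAlgebra.μ.map 1) x = 0
  rw [h]
  rfl

theorem cohomologyMul_mem {i j : ℤ} {x y : 𝓐.Cohomology} (hx : x ∈ 𝓐.cohomologyGr i)
    (hy : y ∈ 𝓐.cohomologyGr j) : 𝓐.cohomologyMul x y ∈ 𝓐.cohomologyGr (i + j) := by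
  obtain ⟨x, hx, rfl⟩ := hx
  obtain ⟨y, hy, rfl⟩ := hy
  exact ⟨_, 𝓐.mul_mem (show (x : A) ∈ _ from hx) (show (y : A) ∈ _ from hy), rfl⟩

/-- The Euler vector field is a derivation of the product on cohomology. -/
theorem euler_cohomologyMul (x y : 𝓐.Cohomology) :
    euler 𝓐.cohomologyGr_internal (𝓐.cohomologyMul x y) =
      𝓐.cohomologyMul (euler 𝓐.cohomologyGr_internal x) y +
        𝓐.cohomologyMul x (euler 𝓐.cohomologyGr_internal y) := by
  have hg := 𝓐.cohomologyGr_internal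
  have h1 : ∀ i, ∀ x ∈ 𝓐.cohomologyGr i, euler hg ∘ₗ 𝓐.cohomologyMul x =
      𝓐.cohomologyMul (euler hg x) + 𝓐.cohomologyMul x ∘ₗ euler hg := by
    intro i x hx
    refine linearMap_ext hg fun j y hy => ?_
    simp only [LinearMap.comp_apply, LinearMap.add_apply]
    rw [euler_of_mem hg (𝓐.cohomologyMul_mem hx hy), euler_of_mem hg hx,
      euler_of_mem hg hy, map_smul, map_smul, LinearMap.smul_apply, ← add_smul, Int.cast_add]
  have hx : x ∈ ⨆ i, 𝓐.cohomologyGr i := by rw [hg.submodule_iSup_eq_top]; trivial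
  induction hx using Submodule.iSup_induction' with
  | mem i x hx => exact LinearMap.congr_fun (h1 i x hx) y
  | zero => simp
  | add x x' _ _ h h' => simp only [map_add, LinearMap.add_apply, h, h']; abel

theorem isMultilinear_square {F : List A → 𝓐.Cohomology} (hF : IsMultilinear k F) :
    IsMultilinear k (𝓐.square F) :=
  hF.splitSum (fun y => hF.comp (𝓐.cohomologyMul.flip y)) (fun _ _ _ => map_add _ _ _)
    (fun _ _ _ => map_smul _ _ _)

theorem isHomogeneous_square {F : List A → 𝓐.Cohomology}
    (hF : IsHomogeneous 𝓐.gr 𝓐.cohomologyGr 1 F) :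
    IsHomogeneous 𝓐.gr 𝓐.cohomologyGr 2 (𝓐.square F) :=
  (hF.splitSum (e' := 1) fun _ y hy => hF.comp (φ := 𝓐.cohomologyMul.flip y)
    fun _ _ hx => 𝓐.cohomologyMul_mem hx hy).degree_eq (by norm_num)

theorem insertion_square_of_euler {b : List A → A} {F : List A → 𝓐.Cohomology}
    (h : ∀ w, insertion (k := k) LinearMap.id b F w = euler 𝓐.cohomologyGr_internal (F w))
    (w : List A) : insertion (k := k) LinearMap.id b (𝓐.square F) w =
      euler 𝓐.cohomologyGr_internal (𝓐.square F w) := by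
  have h2 : insertion (k := k) LinearMap.id b F =
      fun w => euler 𝓐.cohomologyGr_internal (F w) := funext h
  rw [square, insertion_splitSum _ _ (fun y y' w => map_add _ _ _), h2, ← splitSum_comp]
  simp only [𝓐.euler_cohomologyMul]
  rw [splitSum_add_right, add_comm]
  congr 1
  · refine splitSum_congr fun v x _ => ?_
    have hv : v.map (LinearMap.id : A →ₗ[k] A) = v := by simp
    rw [hv]
    exact (insertion_comp _ _ (𝓐.cohomologyMul.flip (F v)) F x).trans (by rw [h2]; rfl)
  · exact splitSum_congr fun _ _ _ => rfl

/-- A homotopy `s` of degree `-1` with `d s d = d` and `s d s = s`. -/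
theorem exists_homotopy : ∃ s : A →ₗ[k] A, (∀ i, ∀ a ∈ 𝓐.gr i, s a ∈ 𝓐.gr (i - 1)) ∧
    (∀ a, 𝓐.d (s (𝓐.d a)) = 𝓐.d a) ∧ ∀ a, s (𝓐.d (s a)) = s a := by
  obtain ⟨g, hg, hd⟩ := exists_graded_generalizedInverse 𝓐.gr_internal 𝓐.gr_internal 𝓐.d 1
    fun i a => 𝓐.d_mem
  refine ⟨g ∘ₗ 𝓐.d ∘ₗ g, fun i a ha => ?_, fun a => ?_, fun a => ?_⟩
  · have := 𝓐.d_mem (hg i a ha)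
    rw [sub_add_cancel] at this
    exact hg _ _ this
  · simp only [LinearMap.comp_apply, hd]
  · simp only [LinearMap.comp_apply, hd]

theorem d_euler (a : A) :
    𝓐.d (euler 𝓐.gr_internal a) = euler 𝓐.gr_internal (𝓐.d a) - 𝓐.d a := by
  have : 𝓐.d ∘ₗ euler 𝓐.gr_internal = euler 𝓐.gr_internal ∘ₗ 𝓐.d - 𝓐.d :=
    linearMap_ext 𝓐.gr_internal fun i a ha => by
      simp only [LinearMap.comp_apply, LinearMap.sub_apply]
      rw [euler_of_mem _ ha, euler_of_mem _ (𝓐.d_mem ha), map_smul]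
      push_cast
      rw [add_smul, one_smul, add_sub_cancel_right]
  exact LinearMap.congr_fun this a

/-! ### Formal implies pure -/

/-- A solution `F` of `F ∘ μ = F · F` with `F¹` a quasi-isomorphism lifts the Euler vector field of
`H(𝓐)` to an **nc**-vector field `b` of `𝓐`. The conditions `s ∘ b = 0` and `(s ∘ μ) ∘ b = 0`, where
`s` is a contracting homotopy, make `b` unique. -/
theorem exists_euler_lift {F : List A → 𝓐.Cohomology} (hF : IsMultilinear k F)
    (hFh : IsHomogeneous 𝓐.gr 𝓐.cohomologyGr 1 F) (hF0 : F [] = 0)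
    {φ : A →ₗ[k] 𝓐.Cohomology} (hF1 : ∀ a, F [a] = φ a)
    (hMC : ∀ w, 𝓐.square F w = insertion 𝓐.sgn 𝓐.ops F w)
    (hsurj : ∀ x, ∃ a, 𝓐.d a = 0 ∧ φ a = x)
    (hinj : ∀ a, 𝓐.d a = 0 → φ a = 0 → ∃ y, 𝓐.d y = a) :
    ∃ b : List A → A, IsMultilinear k b ∧ IsHomogeneous 𝓐.gr 𝓐.gr 1 b ∧ b [] = 0 ∧
      (∀ w, insertion (k := k) LinearMap.id b 𝓐.ops w = insertion 𝓐.sgn 𝓐.ops b w) ∧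
      ∀ w, insertion (k := k) LinearMap.id b F w = euler 𝓐.cohomologyGr_internal (F w) := by
  have hg := 𝓐.cohomologyGr_internal
  have hφmem : ∀ i, ∀ a ∈ 𝓐.gr i, φ a ∈ 𝓐.cohomologyGr i := by
    intro i a ha
    have := hFh [i] [a] (.cons ha .nil)
    rw [hF1] at this
    simpa using this
  -- the equation `F ∘ μ = F · F` in arity one
  have hφd : ∀ a, φ (𝓐.d a) = 0 := by
    intro a
    have h := hMC [a]
    simpa [square, splitSum, insertion_cons, hF0, hF1, ops_singleton] using h.symm
  obtain ⟨s, hs, hdsd, hsds⟩ := 𝓐.exists_homotopy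
  -- a graded section of `φ` by cocycles annihilated by `s`
  obtain ⟨i, him, hφi, hdi, hsi⟩ : ∃ i : 𝓐.Cohomology →ₗ[k] A,
      (∀ j, ∀ x ∈ 𝓐.cohomologyGr j, i x ∈ 𝓐.gr j) ∧ (∀ x, φ (i x) = x) ∧
      (∀ x, 𝓐.d (i x) = 0) ∧ ∀ x, s (i x) = 0 := by
    set P : A →ₗ[k] A := LinearMap.id - s ∘ₗ 𝓐.d with hP
    have hPmem : ∀ j, ∀ a ∈ 𝓐.gr j, P a ∈ 𝓐.gr j := fun j a ha => by
      have := hs _ _ (𝓐.d_mem ha)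
      rw [add_sub_cancel_right] at this
      exact Submodule.sub_mem _ ha this
    have hdP : ∀ a, 𝓐.d (P a) = 0 := fun a => by simp [hP, hdsd]
    obtain ⟨g, hgm, hfg⟩ := exists_graded_generalizedInverse 𝓐.gr_internal hg (φ ∘ₗ P) 0
      fun j a ha => by rw [add_zero]; exact hφmem _ _ (hPmem _ _ ha)
    have hφg : ∀ x, φ (P (g x)) = x := by
      intro x
      obtain ⟨a, ha, rfl⟩ := hsurj x
      have : P a = a := by simp [hP, ha]
      have h := hfg a
      simp only [LinearMap.comp_apply, this] at h
      exact h
    refine ⟨(LinearMap.id - 𝓐.d ∘ₗ s) ∘ₗ P ∘ₗ g, fun j x hx => ?_, fun x => ?_, fun x => ?_,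
      fun x => ?_⟩
    · have h1 := hPmem _ _ (hgm j x hx)
      rw [sub_zero] at h1
      have h2 := 𝓐.d_mem (hs _ _ h1)
      rw [sub_add_cancel] at h2
      exact Submodule.sub_mem _ h1 h2
    · simp [hφd, hφg]
    · simp [𝓐.d_d, hdP]
    · simp [hsds]
  -- If `x` and `s y` are the values required of `F¹ b` and of `-s d b` by lower arities, then
  -- `b = i x - ρ y` satisfies both conditions, and `s b = 0`.
  set ρ : A →ₗ[k] A := (LinearMap.id - i ∘ₗ φ) ∘ₗ (LinearMap.id - 𝓐.d ∘ₗ s) ∘ₗ s with hρ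
  have hρmem : ∀ j, ∀ a ∈ 𝓐.gr j, ρ a ∈ 𝓐.gr (j + -1) := by
    intro j a ha
    rw [← sub_eq_add_neg]
    have h1 := hs j a ha
    have h2 := 𝓐.d_mem (hs _ _ h1)
    rw [sub_add_cancel] at h2
    have h3 := Submodule.sub_mem _ h1 h2
    exact Submodule.sub_mem _ h3 (him _ _ (hφmem _ _ h3))
  have hid : ∀ j, ∀ a ∈ 𝓐.gr j, (LinearMap.id : A →ₗ[k] A) a ∈ 𝓐.gr j := fun _ _ h => h
  obtain ⟨b, hb, hbh, hbeq⟩ := exists_fixedPoint (k := k) (gA := 𝓐.gr) (gW := 𝓐.gr) (e := 1)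
    (fun b w => i (euler hg (F w) - insertion (k := k) LinearMap.id b (AInfinity.higherPart F) w) -
      ρ (insertion (k := k) LinearMap.id b (AInfinity.higherPart 𝓐.ops) w))
    (fun b hb => (((hF.comp _).sub (hb.insertion _ hF.higherPart)).comp i).sub
      ((hb.insertion _ 𝓐.isMultilinear_ops.higherPart).comp ρ))
    (fun b hb => (((hFh.comp' fun _ _ => euler_mem hg).sub
      ((hb.insertion hid hFh.higherPart).degree_eq (by norm_num))).comp' him).sub
      (((hb.insertion hid 𝓐.isHomogeneous_ops.higherPart).comp hρmem).degree_eq (by norm_num)))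
    (fun b b' n _ _ h w hw => by
      simp only [insertion_higherPart_congr_left _ h hw])
  have hb0 : b [] = 0 := by simpa [hF0] using (hbeq []).symm
  have hFsplit : F = fun w => arityOne φ w + AInfinity.higherPart F w :=
    funext fun w => (arityOne_add_higherPart hF0 hF1 w).symm
  have hosplit : 𝓐.ops = fun w => arityOne 𝓐.d w + AInfinity.higherPart 𝓐.ops w :=
    funext 𝓐.ops_eq_arityOne_add_higherPart
  have insF : ∀ (ε : A →ₗ[k] A) {c : List A → A} (_ : c [] = 0) w, insertion ε c F w =
      φ (c w) + insertion ε c (AInfinity.higherPart F) w := by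
    intro ε c hc w
    conv_lhs => rw [hFsplit]
    rw [insertion_add, insertion_arityOne _ _ _ hc]
  have insO : ∀ (ε : A →ₗ[k] A) {c : List A → A} (_ : c [] = 0) w, insertion ε c 𝓐.ops w =
      𝓐.d (c w) + insertion ε c (AInfinity.higherPart 𝓐.ops) w := by
    intro ε c hc w
    conv_lhs => rw [hosplit]
    rw [insertion_add, insertion_arityOne _ _ _ hc]
  have hbF : ∀ w, insertion (k := k) LinearMap.id b F w = euler hg (F w) := by
    intro w
    rw [insF _ hb0]
    conv_lhs => rw [← hbeq w]
    simp [hρ, hφi]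
  have hsb : ∀ w, s (b w) = 0 := by
    intro w
    rw [← hbeq w]
    simp [hρ, hsi, hsds]
  have hsbO : ∀ w, s (insertion (k := k) LinearMap.id b 𝓐.ops w) = 0 := by
    intro w
    rw [insO _ hb0]
    conv_lhs => rw [← hbeq w]
    simp [hρ, hdi, hsds, 𝓐.d_d]
  refine ⟨b, hb, hbh, hb0, ?_, hbF⟩
  -- the commutator of `b` and `μ`
  set c : List A → A := fun v => insertion (k := k) LinearMap.id b 𝓐.ops v -
    insertion 𝓐.sgn 𝓐.ops b v with hc
  have hc0 : c [] = 0 := by simp [hc]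
  have hsc : ∀ w, s (c w) = 0 := by
    intro w
    have h : (fun x => s (b x)) = fun _ => 0 := funext hsb
    rw [hc, map_sub, hsbO, ← insertion_comp, h, insertion_zero, sub_zero]
  have hcO : ∀ w, insertion 𝓐.sgn c (fun x => s (𝓐.ops x)) w = 0 := by
    intro w
    have h1 : insertion 𝓐.sgn 𝓐.ops (fun x => s (𝓐.ops x)) = fun _ => 0 := funext fun w => by
      rw [insertion_comp, 𝓐.insertion_ops_ops, map_zero]
    have h2 : insertion (k := k) LinearMap.id b (fun x => s (𝓐.ops x)) = fun _ => 0 :=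
      funext fun w => by rw [insertion_comp, hsbO]
    rw [hc, ← 𝓐.insertion_comm hb hbh (𝓐.isMultilinear_ops.comp s), h1, h2, insertion_zero,
      insertion_zero, sub_zero]
  have hcF : ∀ w, insertion 𝓐.sgn c F w = 0 := by
    intro w
    rw [hc, ← 𝓐.insertion_comm hb hbh hF, sub_eq_zero]
    have h1 : insertion 𝓐.sgn 𝓐.ops F = 𝓐.square F := funext fun w => (hMC w).symm
    have h2 : insertion (k := k) LinearMap.id b F = fun w => euler hg (F w) := funext hbF
    rw [h1, 𝓐.insertion_square_of_euler hbF, h2, insertion_comp, h1]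
  have hcw : ∀ n, ∀ w : List A, w.length < n → c w = 0 := by
    intro n
    induction n with
    | zero => intro w hw; omega
    | succ n ih =>
      intro w hw
      have hlow : ∀ {Y : Type _} [AddCommGroup Y] [Module k Y] {σ : List A → Y},
          IsMultilinear k σ → insertion 𝓐.sgn c (AInfinity.higherPart σ) w = 0 := by
        intro Y _ _ σ hσ
        rw [insertion_higherPart_congr_left (τ' := fun _ => 0) (n := n) _ ih (by omega),
          insertion_zero_left _ hσ.higherPart]
      have h1 := hcF w
      rw [insF _ hc0, hlow hF, add_zero] at h1
      have h2 := hcO w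
      rw [insertion_comp, insO _ hc0, hlow 𝓐.isMultilinear_ops, add_zero] at h2
      have h3 : 𝓐.d (c w) = 0 := by rw [← hdsd, h2, map_zero]
      obtain ⟨y, hy⟩ := hinj _ h3 h1
      rw [← hy, ← hdsd, hy, hsc, map_zero]
  intro w
  exact sub_eq_zero.1 (hcw _ w (Nat.lt_succ_self _))

/-- Over any field, a formal `A∞`-algebra is pure. -/
theorem isPure_of_isFormal (h : 𝓐.IsFormal) : 𝓐.IsPure := by
  obtain ⟨F, hinj, hsurj⟩ := h
  set f := F.cochain.toFun with hf
  have hfm : IsMultilinear k f := F.cochain.isMultilinear_toFun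
  have hfh : IsHomogeneous 𝓐.gr 𝓐.cohomologyGr 1 f := F.cochain.isHomogeneous_toFun
  have hker : ∀ a, 𝓐.d a = 0 → F.cochain.linear a = 0 → ∃ y, 𝓐.d y = a := by
    intro a ha h0
    refine (𝓐.cls_eq_zero ⟨a, ha⟩).1 (hinj ?_)
    rw [map_zero, Hom.onCohomology, cohomologyMap_cls, cls_eq_zero]
    exact ⟨0, by rw [map_zero]; exact h0.symm⟩
  obtain ⟨b, hb, hbh, hb0, hcomm, heu⟩ := 𝓐.exists_euler_lift hfm hfh
    (F.cochain.toFun_nil F.cochain_zero) (φ := F.cochain.linear) F.cochain.toFun_singleton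
    (by
      refine (𝓐.isMultilinear_square hfm).ext_homogeneous 𝓐.gr_internal
        (𝓐.isMultilinear_ops.insertion _ hfm) ?_
      intro p w hw
      obtain ⟨p', a, ha, hw⟩ := exists_word_of_hasDegrees hw
      have := F.relation p' a ha w.length
      rw [𝓐.convolution_ops _ ha] at this
      rw [← hw, ← this]
      exact (𝓐.sum_composition_cohomology F.cochain F.cochain_zero a _).symm)
    (by
      intro x
      obtain ⟨z, hz⟩ := hsurj (𝓐.cohomologyAlgebra.cls ⟨x, 𝓐.cohomologyAlgebra_d x⟩)
      obtain ⟨a, rfl⟩ := 𝓐.cls_surjective z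
      refine ⟨a, a.2, ?_⟩
      rw [Hom.onCohomology, cohomologyMap_cls, ← sub_eq_zero, ← map_sub, cls_eq_zero] at hz
      obtain ⟨y, hy⟩ := hz
      rw [cohomologyAlgebra_d] at hy
      exact sub_eq_zero.1 hy.symm)
    hker
  have hfun : (Cochain.ofFun b hb hbh).toFun = b := funext (Cochain.toFun_ofFun b hb hbh)
  have h0 := Cochain.ofFun_zero hb hbh hb0
  refine ⟨⟨Cochain.ofFun b hb hbh, (𝓐.isCocycle_iff _ h0).2 (by rwa [hfun])⟩, h0,
    linearMap_ext 𝓐.cohomologyGr_internal ?_⟩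
  rintro i x hx
  rw [euler_of_mem _ hx]
  obtain ⟨z, hz, rfl⟩ := hx
  have hz' : (z : A) ∈ 𝓐.gr i := hz
  rw [NcVectorField.inducedEnd, cohomologyMap_cls, ← map_smul, ← sub_eq_zero, ← map_sub,
    cls_eq_zero]
  refine hker _ (LinearMap.mem_ker.1 (Subtype.prop _)) ?_
  have h1 : (Cochain.ofFun b hb hbh).linear (z : A) = b [(z : A)] := by
    rw [← Cochain.toFun_singleton, hfun]
  have h2 : F.cochain.linear (b [(z : A)]) = (i : k) • F.cochain.linear (z : A) := by
    have h3 : f [(z : A)] ∈ 𝓐.cohomologyGr i := by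
      simpa using hfh [i] [(z : A)] (.cons hz' .nil)
    have h4 := heu [(z : A)]
    rw [euler_of_mem _ h3] at h4
    rw [← F.cochain.toFun_singleton, ← F.cochain.toFun_singleton]
    simpa [insertion_cons, splitSum] using h4
  change F.cochain.linear ((Cochain.ofFun b hb hbh).linear (z : A) - (i : k) • (z : A)) = 0
  rw [map_sub, map_smul, h1, h2, sub_self]

/-! ### Pure implies formal -/

/-- The Hochschild coboundary of a linear map of degree `-1` is a derivation commuting with `μ`. -/
theorem insertion_coboundary_comm {h : A →ₗ[k] A} (hh : ∀ i, ∀ a ∈ 𝓐.gr i, h a ∈ 𝓐.gr (i - 1))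
    (w : List A) :
    insertion (k := k) LinearMap.id
        (fun v => insertion 𝓐.sgn (arityOne h) 𝓐.ops v + h (𝓐.ops v)) 𝓐.ops w =
      insertion 𝓐.sgn 𝓐.ops (fun v => insertion 𝓐.sgn (arityOne h) 𝓐.ops v + h (𝓐.ops v)) w := by
  have h0 : insertion 𝓐.sgn 𝓐.ops 𝓐.ops = fun _ => 0 := funext 𝓐.insertion_ops_ops
  have hlin : IsHomogeneous 𝓐.gr 𝓐.gr 0 (arityOne h) :=
    .arityOne fun i a ha => by rw [add_zero]; exact hh i a ha
  have key := insertion_insertion (ε₁ := 𝓐.sgn) (ε₂ := 𝓐.sgn) (τ₁ := 𝓐.ops) (τ₂ := arityOne h)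
    (η := (-1 : k)) (fun _ => rfl) (by norm_num) 𝓐.ops_map_sgn
    (fun v => by
      have := hlin.map_signOp 𝓐.gr_internal (isMultilinear_arityOne h) v
      rwa [zero_sub, zpow_neg_one, inv_neg, inv_one] at this)
    𝓐.isMultilinear_ops w
  simp only [neg_smul, one_smul, sub_neg_eq_add, h0, insertion_zero, zero_add,
    insertion_arityOne 𝓐.sgn h 𝓐.ops 𝓐.ops_nil] at key
  rw [show 𝓐.sgn ∘ₗ 𝓐.sgn = LinearMap.id from signOp_signOp _] at key
  rw [← key, insertion_add, insertion_comp, h0, map_zero, add_zero]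

/-- An **nc**-vector field inducing the Euler vector field on cohomology can be changed by a
coboundary so that its linear part becomes `a ↦ |a| a + s (d a)`. -/
theorem exists_normalized {s : A →ₗ[k] A} (hs : ∀ i, ∀ a ∈ 𝓐.gr i, s a ∈ 𝓐.gr (i - 1))
    (hdsd : ∀ a, 𝓐.d (s (𝓐.d a)) = 𝓐.d a) {b : List A → A} (hb : IsMultilinear k b)
    (hbh : IsHomogeneous 𝓐.gr 𝓐.gr 1 b) (hb0 : b [] = 0) {β : A →ₗ[k] A}
    (hb1 : ∀ a, b [a] = β a)
    (hcomm : ∀ w, insertion (k := k) LinearMap.id b 𝓐.ops w = insertion 𝓐.sgn 𝓐.ops b w)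
    (hpure : ∀ i, ∀ a ∈ 𝓐.gr i, 𝓐.d a = 0 → ∃ y, 𝓐.d y = β a - (i : k) • a) :
    ∃ b' : List A → A, IsMultilinear k b' ∧ IsHomogeneous 𝓐.gr 𝓐.gr 1 b' ∧ b' [] = 0 ∧
      (∀ a, b' [a] = euler 𝓐.gr_internal a + s (𝓐.d a)) ∧
      ∀ w, insertion (k := k) LinearMap.id b' 𝓐.ops w = insertion 𝓐.sgn 𝓐.ops b' w := by
  have hβd : ∀ a, 𝓐.d (β a) = β (𝓐.d a) := by
    intro a
    have := hcomm [a]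
    simpa [insertion_cons, splitSum, hb1, ops_singleton] using this
  set f : A →ₗ[k] A := β - (euler 𝓐.gr_internal + s ∘ₗ 𝓐.d) with hf
  have hfd : ∀ a, 𝓐.d (f a) = f (𝓐.d a) := by
    intro a
    simp only [hf, LinearMap.sub_apply, LinearMap.add_apply, LinearMap.comp_apply, map_sub,
      map_add, hβd, 𝓐.d_euler, hdsd, 𝓐.d_d, map_zero, add_zero, sub_add_cancel]
  have hfmem : ∀ i, ∀ a ∈ 𝓐.gr i, f a ∈ 𝓐.gr i := by
    intro i a ha
    have h1 : β a ∈ 𝓐.gr i := by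
      have := hbh [i] [a] (.cons ha .nil)
      rw [hb1] at this
      simpa using this
    have h2 := hs _ _ (𝓐.d_mem ha)
    rw [add_sub_cancel_right] at h2
    exact Submodule.sub_mem _ h1 (Submodule.add_mem _ (euler_mem _ ha) h2)
  have hfex : ∀ a, 𝓐.d a = 0 → ∃ y, 𝓐.d y = f a := by
    intro a ha
    have ha' := 𝓐.cocycle_mem ha
    change f a ∈ LinearMap.range 𝓐.d
    induction ha' using Submodule.iSup_induction' with
    | mem i a h =>
      obtain ⟨y, hy⟩ := hpure i a h.1 h.2
      refine ⟨y, ?_⟩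
      rw [hy, hf, LinearMap.sub_apply, LinearMap.add_apply, euler_of_mem _ h.1,
        LinearMap.comp_apply, LinearMap.mem_ker.1 h.2, map_zero, add_zero]
    | zero => simp
    | add x y hx hy ihx ihy =>
      have hk : (⨆ i, 𝓐.gr i ⊓ LinearMap.ker 𝓐.d) ≤ LinearMap.ker 𝓐.d :=
        iSup_le fun i => inf_le_right
      rw [map_add]
      exact Submodule.add_mem _ (ihx (hk hx)) (ihy (hk hy))
  set π : A →ₗ[k] A := LinearMap.id - 𝓐.d ∘ₗ s - s ∘ₗ 𝓐.d with hπ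
  have hdπ : ∀ a, 𝓐.d (π a) = 0 := fun a => by simp [hπ, hdsd, 𝓐.d_d]
  have hπd : ∀ a, π (𝓐.d a) = 0 := fun a => by simp [hπ, hdsd, 𝓐.d_d]
  have hπmem : ∀ i, ∀ a ∈ 𝓐.gr i, π a ∈ 𝓐.gr i := by
    intro i a ha
    have h1 := 𝓐.d_mem (hs _ _ ha)
    rw [sub_add_cancel] at h1
    have h2 := hs _ _ (𝓐.d_mem ha)
    rw [add_sub_cancel_right] at h2
    exact Submodule.sub_mem _ (Submodule.sub_mem _ ha h1) h2
  have hdsf : ∀ a, 𝓐.d (s (f (π a))) = f (π a) := by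
    intro a
    obtain ⟨y, hy⟩ := hfex _ (hdπ a)
    rw [← hy, hdsd]
  -- As `1 - π = d s + s d`, `f` is homotopic to `f π`, which is a coboundary valued map.
  set h : A →ₗ[k] A := f ∘ₗ s + s ∘ₗ f ∘ₗ π with hh
  have hhmem : ∀ i, ∀ a ∈ 𝓐.gr i, h a ∈ 𝓐.gr (i - 1) := fun i a ha =>
    Submodule.add_mem _ (hfmem _ _ (hs _ _ ha)) (hs _ _ (hfmem _ _ (hπmem _ _ ha)))
  have hhom : ∀ a, 𝓐.d (h a) + h (𝓐.d a) = f a := by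
    intro a
    have e1 : 𝓐.d (s a) + s (𝓐.d a) + π a = a := by
      simp only [hπ, LinearMap.sub_apply, LinearMap.id_apply, LinearMap.comp_apply]; abel
    conv_rhs => rw [← e1]
    simp only [hh, LinearMap.add_apply, LinearMap.comp_apply, map_add, hdsf, hπd, hfd, map_zero,
      add_zero]
    abel
  have hid : ∀ j, ∀ a ∈ 𝓐.gr j, 𝓐.sgn a ∈ 𝓐.gr j := fun _ _ h => signOp_mem _ h
  have hlin : IsHomogeneous 𝓐.gr 𝓐.gr 0 (arityOne h) :=
    .arityOne fun i a ha => by rw [add_zero]; exact hhmem i a ha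
  have hXm : IsMultilinear k fun v => insertion 𝓐.sgn (arityOne h) 𝓐.ops v + h (𝓐.ops v) :=
    ((isMultilinear_arityOne h).insertion _ 𝓐.isMultilinear_ops).add (𝓐.isMultilinear_ops.comp h)
  refine ⟨fun v => b v - (insertion 𝓐.sgn (arityOne h) 𝓐.ops v + h (𝓐.ops v)), hb.sub hXm,
    hbh.sub (((hlin.insertion hid 𝓐.isHomogeneous_ops).degree_eq (by norm_num)).add
      ((𝓐.isHomogeneous_ops.comp hhmem).degree_eq (by norm_num))), ?_, fun a => ?_, fun w => ?_⟩
  · simp [hb0, ops_nil]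
  · have : insertion 𝓐.sgn (arityOne h) 𝓐.ops [a] = 𝓐.d (h a) := by
      simp [insertion_cons, splitSum, ops_singleton]
    dsimp only
    rw [this, ops_singleton, hhom, hb1, hf]
    simp
  · rw [insertion_sub_left _ _ 𝓐.isMultilinear_ops, insertion_sub, hcomm,
      𝓐.insertion_coboundary_comm hhmem]

variable [CharZero k]

/-- A normalized **nc**-vector field determines a solution of `F ∘ μ = F · F` whose linear part is a
projection to cohomology: the solution of `F ∘ b = euler ∘ F`. -/
theorem exists_square_solution {s : A →ₗ[k] A} (hs : ∀ i, ∀ a ∈ 𝓐.gr i, s a ∈ 𝓐.gr (i - 1))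
    (hdsd : ∀ a, 𝓐.d (s (𝓐.d a)) = 𝓐.d a) (hsds : ∀ a, s (𝓐.d (s a)) = s a)
    {b : List A → A} (hb : IsMultilinear k b)
    (hbh : IsHomogeneous 𝓐.gr 𝓐.gr 1 b) (hb0 : b [] = 0)
    (hb1 : ∀ a, b [a] = euler 𝓐.gr_internal a + s (𝓐.d a))
    (hcomm : ∀ w, insertion (k := k) LinearMap.id b 𝓐.ops w = insertion 𝓐.sgn 𝓐.ops b w) :
    ∃ F : List A → 𝓐.Cohomology, IsMultilinear k F ∧ IsHomogeneous 𝓐.gr 𝓐.cohomologyGr 1 F ∧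
      F [] = 0 ∧ (∀ z : LinearMap.ker 𝓐.d, F [(z : A)] = 𝓐.cls z) ∧
      ∀ w, insertion 𝓐.sgn 𝓐.ops F w = 𝓐.square F w := by
  have hg := 𝓐.cohomologyGr_internal
  set π : A →ₗ[k] A := LinearMap.id - 𝓐.d ∘ₗ s - s ∘ₗ 𝓐.d with hπ
  have hdπ : ∀ a, 𝓐.d (π a) = 0 := fun a => by simp [hπ, hdsd, 𝓐.d_d]
  have hπmem : ∀ i, ∀ a ∈ 𝓐.gr i, π a ∈ 𝓐.gr i := by
    intro i a ha
    have h1 := 𝓐.d_mem (hs _ _ ha)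
    rw [sub_add_cancel] at h1
    have h2 := hs _ _ (𝓐.d_mem ha)
    rw [add_sub_cancel_right] at h2
    exact Submodule.sub_mem _ (Submodule.sub_mem _ ha h1) h2
  set φ : A →ₗ[k] 𝓐.Cohomology := 𝓐.cls ∘ₗ π.codRestrict (LinearMap.ker 𝓐.d) hdπ with hφ
  have hφcls : ∀ z : LinearMap.ker 𝓐.d, φ z = 𝓐.cls z := by
    intro z
    rw [← sub_eq_zero, hφ, LinearMap.comp_apply, ← map_sub, cls_eq_zero]
    refine ⟨-s z, ?_⟩
    have hz : 𝓐.d z = 0 := z.2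
    simp [hπ, hz]
  have hφd : ∀ a, φ (𝓐.d a) = 0 := by
    intro a
    rw [hφcls ⟨𝓐.d a, 𝓐.d_d a⟩, cls_eq_zero]
    exact ⟨a, rfl⟩
  set e : A →ₗ[k] A := s ∘ₗ 𝓐.d with he
  have hee : ∀ a, e (e a) = e a := fun a => by simp [he, hsds]
  have hde : ∀ a, 𝓐.d (a - e a) = 0 := fun a => by simp [he, hdsd]
  have hφe : ∀ a, φ (e a) = 0 := by
    intro a
    rw [hφ, LinearMap.comp_apply, cls_eq_zero]
    refine ⟨-s (s (𝓐.d a)), ?_⟩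
    simp [hπ, he, hsds]
  have hemem : ∀ i, ∀ a ∈ 𝓐.gr i, e a ∈ 𝓐.gr i := by
    intro i a ha
    have h2 := hs _ _ (𝓐.d_mem ha)
    rwa [add_sub_cancel_right] at h2
  have hφmem : ∀ i, ∀ a ∈ 𝓐.gr i, φ a ∈ 𝓐.cohomologyGr i := fun i a ha =>
    ⟨_, hπmem i a ha, rfl⟩
  have hid : ∀ j, ∀ a ∈ 𝓐.gr j, (LinearMap.id : A →ₗ[k] A) a ∈ 𝓐.gr j := fun _ _ h => h
  have hbsplit : b = fun w =>
      (arityOne (euler 𝓐.gr_internal) w + arityOne e w) + AInfinity.higherPart b w := by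
    funext w
    match w with
    | [] => simp [hb0]
    | [a] => simp [hb1, he]
    | _ :: _ :: _ => simp
  -- `b` acts on cochains of degree `n`, relative to the Euler vector field of `H(𝓐)`
  have action : ∀ {G : List A → 𝓐.Cohomology} {n : ℤ}, IsMultilinear k G →
      IsHomogeneous 𝓐.gr 𝓐.cohomologyGr n G → ∀ w,
      insertion (k := k) LinearMap.id b G w = euler hg (G w) ↔
        ((w.length : k) - n) • G w + insertion (k := k) LinearMap.id (arityOne e) G w =
          -insertion (k := k) LinearMap.id (AInfinity.higherPart b) G w := by
    intro G n hG hGh w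
    conv_lhs => rw [hbsplit]
    rw [insertion_add_left _ _ hG, insertion_add_left _ _ hG,
      euler_apply_of_isHomogeneous 𝓐.gr_internal hg hG hGh, ← neg_sub (n : k), neg_smul,
      ← sub_eq_zero, ← sub_eq_zero (b := -_)]
    refine Eq.congr ?_ rfl
    abel
  -- `(n - 1) + E`, with `E` the action of `e`, is inverted in arity `n ≥ 2`
  obtain ⟨F, hF, hFh, hFeq⟩ := exists_fixedPoint (k := k) (gA := 𝓐.gr) (gW := 𝓐.cohomologyGr)
    (e := 1)
    (fun F w => arityOne φ w + AInfinity.higherPart (fun v => -shiftInv e ((v.length : k) - 1)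
      (insertion (k := k) LinearMap.id (AInfinity.higherPart b) F) v) w)
    (fun F hF => (isMultilinear_arityOne φ).add (IsMultilinear.higherPart (IsMultilinear.of_length
      (g := fun n v => -shiftInv e ((n : k) - 1)
        (insertion (k := k) LinearMap.id (AInfinity.higherPart b) F) v)
      fun n => ((hb.higherPart.insertion _ hF).shiftInv e _).neg)))
    (fun F hF => (IsHomogeneous.arityOne fun i a ha => by
        rw [sub_add_cancel]; exact hφmem i a ha).add (IsHomogeneous.higherPart fun p w h =>
      ((((hbh.higherPart.insertion hid hF).degree_eq (by norm_num)).shiftInv hemem _).neg p w h)))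
    (fun F F' n hF hF' h w hw => by
      match w, hw with
      | [], _ => simp
      | [a], _ => simp
      | a :: a' :: w, hw =>
        simp only [higherPart_cons_cons]
        rw [shiftInv_congr]
        intro v hv
        exact insertion_higherPart_congr_right _ hF hF' h (by rw [hv]; exact hw))
  have hF0 : F [] = 0 := by simpa using (hFeq []).symm
  have hF1 : ∀ a, F [a] = φ a := fun a => by simpa using (hFeq [a]).symm
  have hbF : ∀ w, insertion (k := k) LinearMap.id b F w = euler hg (F w) := by
    intro w
    rw [action hF hFh w]
    match w with
    | [] => simp [hF0]
    | [a] => simp [insertion_cons, splitSum, hF1, hφe]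
    | a :: a' :: w =>
      set n := (a :: a' :: w).length with hn
      set K := insertion (k := k) LinearMap.id (AInfinity.higherPart b) F with hK
      have hKm : IsMultilinear k K := hb.higherPart.insertion _ hF
      have hFn : ∀ v : List A, v.length = n → F v = -shiftInv e ((n : k) - 1) K v := by
        intro v hv
        match v with
        | [] => simp [hn] at hv
        | [_] => simp [hn] at hv
        | _ :: _ :: _ => rw [← hFeq, ← hv]; simp
      rw [insertion_arityOne_congr_right _ hF (hKm.shiftInv e _).neg hFn, hFn _ rfl, insertion_neg,
        smul_neg, ← neg_add, Int.cast_one]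
      congr 1
      refine shiftInv_spec e hee (fun m => ?_) hKm _
      have h1 : (n : k) - 1 + m = ((w.length + 1 + m : ℕ) : k) := by
        rw [hn]; simp
      rw [h1]
      exact Nat.cast_ne_zero.2 (by omega)
  refine ⟨F, hF, hFh, hF0, fun z => by rw [hF1, hφcls], ?_⟩
  -- the failure of `F` to be a homomorphism satisfies `O ∘ b = euler ∘ O` too
  set O : List A → 𝓐.Cohomology := fun w => insertion 𝓐.sgn 𝓐.ops F w - 𝓐.square F w with hO
  have hsgn : ∀ j, ∀ a ∈ 𝓐.gr j, 𝓐.sgn a ∈ 𝓐.gr j := fun _ _ h => signOp_mem _ h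
  have hOm : IsMultilinear k O :=
    (𝓐.isMultilinear_ops.insertion _ hF).sub (𝓐.isMultilinear_square hF)
  have hOh : IsHomogeneous 𝓐.gr 𝓐.cohomologyGr 2 O :=
    ((𝓐.isHomogeneous_ops.insertion hsgn hFh).degree_eq (by norm_num)).sub
      (𝓐.isHomogeneous_square hFh)
  have hbO : ∀ w, insertion (k := k) LinearMap.id b O w = euler hg (O w) := by
    intro w
    have h1 := 𝓐.insertion_comm hb hbh hF w
    simp only [hcomm, sub_self] at h1
    rw [insertion_zero_left _ hF, sub_eq_zero, funext hbF, insertion_comp] at h1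
    rw [hO, insertion_sub, h1, 𝓐.insertion_square_of_euler hbF, map_sub]
  have hOw : ∀ n, ∀ w : List A, w.length < n → O w = 0 := by
    intro n
    induction n with
    | zero => intro w hw; omega
    | succ n ih =>
      have hlow : ∀ w : List A, w.length = n →
          ((n : k) - 2) • O w + insertion (k := k) LinearMap.id (arityOne e) O w = 0 := by
        intro w hw
        have h1 := (action hOm hOh w).1 (hbO w)
        rw [insertion_higherPart_congr_right (σ' := fun _ => 0) _ hOm .zero ih hw.le,
          insertion_zero, neg_zero, hw] at h1
        exact_mod_cast h1
      intro w hw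
      rcases Nat.lt_or_ge w.length n with h | h
      · exact ih w h
      have hwn : w.length = n := by omega
      match w, hwn with
      | [], _ => simp [hO, square, splitSum, hF0]
      | [a], _ =>
        simp [hO, square, splitSum, insertion_cons, hF0, hF1, ops_singleton, hφd]
      | [x, y], hwn =>
        obtain rfl : 2 = n := hwn
        -- the constant `n - 2` is zero, so only the reduction to pairs of cocycles is available
        have h2 : ∀ x y, O [x, e y] + O [e x, y] = 0 := by
          intro x y
          have h1 := hlow [x, y] rfl
          rw [insertion_arityOne_left _ hOm, insertion_arityOne_left _ (hOm.cons _)] at h1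
          simpa using h1
        have h3 : ∀ x y, O [e x, y] = 0 := by
          intro x y
          have h4 := h2 (e x) (e y)
          rw [hee, hee, ← two_smul k, smul_eq_zero_iff_right two_ne_zero] at h4
          have h5 := h2 (e x) y
          rwa [hee, h4, zero_add] at h5
        have h4 : ∀ x y, O [x, e y] = 0 := fun x y => by
          have := h2 x y
          rwa [h3, add_zero] at this
        have h5 : O [x, y] = O [x - e x, y - e y] := by
          rw [hOm.cons_sub, h3, sub_zero, (hOm.cons x).cons_sub, h4, sub_zero]
        have h6 : ∀ x y : LinearMap.ker 𝓐.d, O [(x : A), (y : A)] = 0 := by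
          intro x y
          have hx : 𝓐.d x = 0 := x.2
          have hy : 𝓐.d y = 0 := y.2
          have z1 : ∀ a, F [a, 0] = 0 := fun a => (hF.cons a).cons_zero []
          have e1 := hφcls ⟨_, 𝓐.mul_cocycle y.2 x.2⟩
          dsimp only at e1
          simp [hO, square, splitSum, insertion_cons, hF0, hF1, ops_singleton, ops_pair, hx, hy,
            hφcls, hF.cons_zero, z1, e1, cohomologyMul_cls]
        rw [h5]
        exact h6 ⟨_, hde x⟩ ⟨_, hde y⟩
      | x :: y :: z :: w, hwn =>
        refine eq_zero_of_shift e hee hOm (fun m _ => ?_) hlow _ hwn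
        have h1 : (n : k) - 2 + m = ((w.length + 1 + m : ℕ) : k) := by
          rw [← hwn]; simp; ring
        rw [h1]
        exact Nat.cast_ne_zero.2 (by omega)
  exact fun w => sub_eq_zero.1 (hOw _ w (Nat.lt_succ_self _))

/-- In characteristic zero, a pure `A∞`-algebra is formal. -/
theorem isFormal_of_isPure (h : 𝓐.IsPure) : 𝓐.IsFormal := by
  obtain ⟨b, h0, hb⟩ := h
  obtain ⟨s, hs, hdsd, hsds⟩ := 𝓐.exists_homotopy
  obtain ⟨b', hm, hh, hnil, hsing, hcomm⟩ := 𝓐.exists_normalized hs hdsd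
    b.cochain.isMultilinear_toFun b.cochain.isHomogeneous_toFun (b.cochain.toFun_nil h0)
    b.cochain.toFun_singleton ((𝓐.isCocycle_iff _ h0).1 b.isCocycle) (by
      intro i a ha hda
      have hx : 𝓐.cls ⟨a, hda⟩ ∈ 𝓐.cohomologyGr i := ⟨_, ha, rfl⟩
      have h1 := LinearMap.congr_fun hb (𝓐.cls ⟨a, hda⟩)
      rw [euler_of_mem _ hx, NcVectorField.inducedEnd, cohomologyMap_cls, ← map_smul,
        ← sub_eq_zero, ← map_sub, cls_eq_zero] at h1
      exact h1)
  obtain ⟨F, hF, hFh, hF0, hF1, hMC⟩ := 𝓐.exists_square_solution hs hdsd hsds hm hh hnil hsing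
    hcomm
  have hfun : (Cochain.ofFun F hF hFh).toFun = F := funext (Cochain.toFun_ofFun F hF hFh)
  have hz := Cochain.ofFun_zero hF hFh hF0
  let Φ : Hom 𝓐 𝓐.cohomologyAlgebra :=
    { cochain := Cochain.ofFun F hF hFh
      cochain_zero := hz
      relation := fun p a ha n => by
        have h1 := 𝓐.sum_composition_cohomology (Cochain.ofFun F hF hFh) hz a n
        have h2 := 𝓐.convolution_ops (Cochain.ofFun F hF hFh) ha n
        rw [hfun, ← hMC] at h1
        rw [hfun] at h2
        exact h1.trans h2.symm }
  have hΦ : ∀ z : LinearMap.ker 𝓐.d, Φ.cochain.linear z = 𝓐.cls z := fun z => by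
    rw [← Cochain.toFun_singleton, ← hF1]
    exact congrFun hfun _
  refine ⟨Φ, (injective_iff_map_eq_zero _).2 fun x hx => ?_, fun x => ?_⟩
  · obtain ⟨z, rfl⟩ := 𝓐.cls_surjective x
    rw [Hom.onCohomology, cohomologyMap_cls, cls_eq_zero] at hx
    obtain ⟨y, hy⟩ := hx
    rw [cohomologyAlgebra_d] at hy
    rw [← hΦ, hy]
  · obtain ⟨y, rfl⟩ := 𝓐.cohomologyAlgebra.cls_surjective x
    obtain ⟨z, hz⟩ := 𝓐.cls_surjective y
    refine ⟨𝓐.cls z, ?_⟩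
    rw [Hom.onCohomology, cohomologyMap_cls]
    congr 1
    exact Subtype.ext ((hΦ z).trans hz)

end AInfAlgebra

end AInfinity

theorem theorem2p3 {k : Type*} [Field k] [CharZero k] {A : Type*} [AddCommGroup A] [Module k A]
    (𝓐 : AInfinity.AInfAlgebra k A) : 𝓐.IsPure ↔ 𝓐.IsFormal :=
  ⟨𝓐.isFormal_of_isPure, 𝓐.isPure_of_isFormal⟩
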